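/- Let $H_4(x)=-x\log_4\frac{x}{3}-(1-x)\log_4(1-x)$, and let $H_4^{-1}:[0,1]\to[0,\tfrac34]$ be the inverse of its increasing branch (with $H_4(0)=0$). An additive code of length $N$ is an additive subgroup $C\subseteq\mathbb F_4^N$; its dual $C^\perp$ is taken with respect to the trace inner product $\langle u,v\rangle=\sum_i(u_i\bar v_i+\bar u_iv_i)$, $\bar x=x^2$. A self-orthogonal additive code $C\subseteq C^\perp$ with $|C|=2^{N-K}$ defines a (stabilizer) quantum code of length $N$, with rate $K/N$ and relative minimum distance $\frac1N\min\{\mathrm{wt}(v): v\in C^\perp\setminus C\}$. Let $s\ge 2$. A generalized concatenated quantum code of order $s$ is the quantum code whose additive code is obtained from the following data, where $m\ge1$ and $n_1=2^m-1$. (a) Outer codes: for $1\le i\le s$ an additive code $B_i=\omega\,\mathcal B(D_i)+\bar\omega\,\mathcal B(D_i)\subseteq(\mathbb F_4^m)^{n_1}$ of a quantum Reed–Solomon code with parameters $[[mn_1,m(n_1-2k_i)]]$. Here $1\le k_i\le 2^{m-1}-1$, $\omega^2=\omega+1$, $D_i$ is the Reed–Solomon code of length $n_1$ and dimension $k_i$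 over $\mathbb F_{2^m}$ with generator polynomial $\prod_{l=0}^{n_1-k_i-1}(x-\alpha^l)$, $\alpha$ primitive, and $\mathcal B(D_i)$ is its binary expansion with respect to a self-dual basis of $\mathbb F_{2^m}$ over $\mathbb F_2$. (b) Inner codes: self-orthogonal additive codes $C_s\subseteq\cdots\subseteq C_1\subseteq\mathbb F_4^{n_2}$ with $|C_j|=2^{n_2-jm}$. (c) An inner-product-preserving map $\rho:(\mathbb F_4^{m})^s\to C_s^\perp/C_s$ of $\mathbb F_2$-spaces such that, for each $j$, $C_j^\perp$ is spanned by $C_j$ and representatives of the images under $\rho$ of the vectors supported on the first $j$ blocks. The resulting additive code in $\mathbb F_4^{n_1n_2}$ consists of all $(w_1,\dots,w_{n_1})$ such that each $w_l\in C_s^\perp$ represents the coset $\rho(b_{1,l},\dots,b_{s,l})$, for some $(b_1,\dots,b_s)\in B_1\oplus\cdots\oplus B_s$ with $b_i=(b_{i,1},\dots,b_{i,n_1})$, $b_{i,l}\in\mathbb F_4^m$. **Theorem.** Let $s\ge2$ and $0<\delta<H_4^{-1}(1/2)$. Then the maximum $$R=\max_{0<r<1-2H_4(\delta)}\left(r-\frac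 rs\sum_{j=1}^s\frac{\delta}{H_4^{-1}\left(\frac12\left(1-\frac{rj}{s}\right)\right)}\right)$$ exists, and there is a sequence of generalized concatenated quantum codes of order $s$ whose lengths $n_1n_2$ tend to infinity, each with relative minimum distance at least $\delta/2$, and whose rates tend to $R$. -/

import Mathlib

open Filter Topology

noncomputable section

namespace GCQ

/-! ## The quaternary entropy function and its inverse -/

/-- The quaternary entropy function
`H₄(x) = -x log₄ (x/3) - (1-x) log₄ (1-x)`, see `H4_eq`. -/
def H4 (x : ℝ) : ℝ := Real.qaryEntropy 4 x / Real.log 4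

theorem H4_eq {x : ℝ} (hx : 0 < x) :
    H4 x = -x * Real.logb 4 (x / 3) - (1 - x) * Real.logb 4 (1 - x) := by
  have h3 : ((4 : ℕ) - 1 : ℤ) = 3 := by norm_num
  simp only [H4, Real.qaryEntropy, Real.binEntropy_eq_negMulLog_add_negMulLog_one_sub,
    Real.negMulLog, Real.logb, h3]
  rw [Real.log_div hx.ne' (by norm_num)]
  push_cast
  ring

/-- The inverse of the increasing bijection `H₄ : [0, 3/4] → [0, 1]`. -/
def H4inv : ℝ → ℝ := Function.invFunOn H4 (Set.Icc 0 (3 / 4))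

theorem surjOn_H4 : Set.SurjOn H4 (Set.Icc 0 (3 / 4)) (Set.Icc 0 1) := by
  have hc : ContinuousOn H4 (Set.Icc 0 (3 / 4)) :=
    (Real.qaryEntropy_continuous.div_const _).continuousOn
  have h := hc.surjOn_Icc (a := 0) (b := 3 / 4) (by norm_num) (by norm_num)
  have h0 : H4 0 = 0 := by simp [H4]
  have h1 : H4 (3 / 4) = 1 := by
    rw [H4_eq (by norm_num)]
    have : (1 - 3 / 4 : ℝ) = 4⁻¹ := by norm_num
    have h' : (3 / 4 / 3 : ℝ) = 4⁻¹ := by norm_num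
    rw [this, h', Real.logb_inv, Real.logb_self_eq_one (by norm_num)]
    norm_num
  rwa [h0, h1] at h

/-! ## Additive codes over `𝔽₄` and stabilizer quantum codes -/

/-- The field with four elements. -/
abbrev F4 : Type := GaloisField 2 2

/-- An additive code over `𝔽₄` with coordinates indexed by `ι`, i.e. an additive subgroup
(equivalently, an `𝔽₂`-subspace) of `𝔽₄^ι`. -/
abbrev AdditiveCode (ι : Type) : Type := Submodule (ZMod 2) (ι → F4)

/-- The trace inner product `∑ (uᵢ v̄ᵢ + ūᵢ vᵢ)`, where `x̄ = x²`. -/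
def traceInner {ι : Type} [Fintype ι] (u v : ι → F4) : F4 :=
  ∑ i, (u i * v i ^ 2 + u i ^ 2 * v i)

/-- The trace-dual `C^⊥`. -/
def traceDual {ι : Type} [Fintype ι] (C : AdditiveCode ι) : AdditiveCode ι where
  carrier := {u | ∀ v ∈ C, traceInner u v = 0}
  zero_mem' := by intro v _; simp [traceInner]
  add_mem' := by
    intro a b ha hb v hv
    have hab : traceInner (a + b) v = traceInner a v + traceInner b v := by
      simp only [traceInner, Pi.add_apply, ← Finset.sum_add_distrib]
      refine Finset.sum_congr rfl fun i _ => ?_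
      rw [add_pow_char]
      ring
    rw [hab, ha v hv, hb v hv, add_zero]
  smul_mem' := by
    intro c a ha v hv
    rcases (by decide : ∀ c : ZMod 2, c = 0 ∨ c = 1) c with rfl | rfl
    · simp [traceInner]
    · simpa using ha v hv

/-- `C` is self-orthogonal; such a `C` defines the (stabilizer) quantum code associated with
`C ⊆ C^⊥`. -/
def IsSelfOrthogonal {ι : Type} [Fintype ι] (C : AdditiveCode ι) : Prop := C ≤ traceDual C

/-- The rate `k / n` of the quantum code associated with an `(n, 2^(n-k))` self-orthogonal additive
code `C`. -/
def quantumRate {ι : Type} [Fintype ι] (C : AdditiveCode ι) : ℝ :=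
  ((Fintype.card ι : ℝ) - (Module.finrank (ZMod 2) C : ℝ)) / (Fintype.card ι : ℝ)

open Classical in
/-- The minimum distance of the quantum code associated with `C`: the least weight of a vector in
`C^⊥ \ C`. (It is `0` if `C^⊥ = C`, so that a lower bound on it is never vacuous.) -/
def quantumMinDist {ι : Type} [Fintype ι] (C : AdditiveCode ι) : ℕ :=
  sInf {w | ∃ v ∈ traceDual C, v ∉ C ∧ hammingNorm v = w}

/-- The relative minimum distance `d / n`. -/
def quantumRelDist {ι : Type} [Fintype ι] (C : AdditiveCode ι) : ℝ :=
  (quantumMinDist C : ℝ) / (Fintype.card ι : ℝ)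

/-! ## Quantum Reed–Solomon codes -/

/-- The Reed–Solomon code of length `2^m - 1` and dimension `k` over `𝔽_{2^m}`: the cyclic code
with generator polynomial `∏_{i=0}^{d-2} (X - α^i)`, where `d - 1 = 2^m - 1 - k`. -/
def rsCode (m k : ℕ) (α : GaloisField 2 m) :
    Submodule (GaloisField 2 m) (Fin (2 ^ m - 1) → GaloisField 2 m) where
  carrier := {c | (∏ i ∈ Finset.range (2 ^ m - 1 - k), (Polynomial.X - Polynomial.C (α ^ i))) ∣
    ∑ l, Polynomial.C (c l) * Polynomial.X ^ (l : ℕ)}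
  zero_mem' := by simp
  add_mem' := by
    intro a b ha hb
    have := dvd_add ha hb
    simpa [add_mul, Finset.sum_add_distrib] using this
  smul_mem' := by
    intro c a ha
    have h := Dvd.dvd.mul_left ha (Polynomial.C c)
    simpa [Finset.mul_sum, mul_assoc] using h

/-- The binary expansion of a linear code over `𝔽_{2^m}` with respect to a basis of `𝔽_{2^m}`
over `𝔽₂`. -/
def binaryExpansion {n m : ℕ} (b : Module.Basis (Fin m) (ZMod 2) (GaloisField 2 m))
    (D : Submodule (GaloisField 2 m) (Fin n → GaloisField 2 m)) :
    Submodule (ZMod 2) (Fin n × Fin m → ZMod 2) where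
  carrier := {c | (fun i => ∑ j, c (i, j) • b j) ∈ D}
  zero_mem' := by
    have : (fun _ : Fin n => (0 : GaloisField 2 m)) ∈ D := D.zero_mem
    simpa using this
  add_mem' := by
    intro x y hx hy
    have h := D.add_mem hx hy
    have e : (fun i => ∑ j, (x + y) (i, j) • b j) =
        (fun i => ∑ j, x (i, j) • b j) + (fun i => ∑ j, y (i, j) • b j) := by
      funext i
      simp [add_smul, Finset.sum_add_distrib]
    change (fun i => ∑ j, (x + y) (i, j) • b j) ∈ D
    rw [e]
    exact h
  smul_mem' := by
    intro c x hx
    rcases (by decide : ∀ c : ZMod 2, c = 0 ∨ c = 1) c with rfl | rfl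
    · have : (fun _ : Fin n => (0 : GaloisField 2 m)) ∈ D := D.zero_mem
      simpa using this
    · simpa using hx

/-- The additive code `ω D + ω̄ D` over `𝔽₄` (with `ω̄ = ω²`) obtained from a binary code `D`. -/
def omegaSum {ι : Type} (ω : F4) (D : Submodule (ZMod 2) (ι → ZMod 2)) : AdditiveCode ι where
  carrier := {v | ∃ x ∈ D, ∃ y ∈ D, ∀ p,
    v p = ω * algebraMap (ZMod 2) F4 (x p) + ω ^ 2 * algebraMap (ZMod 2) F4 (y p)}
  zero_mem' := ⟨0, D.zero_mem, 0, D.zero_mem, by simp⟩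
  add_mem' := by
    rintro a b ⟨x, hx, y, hy, h⟩ ⟨x', hx', y', hy', h'⟩
    refine ⟨x + x', D.add_mem hx hx', y + y', D.add_mem hy hy', fun p => ?_⟩
    simp only [Pi.add_apply, h p, h' p, map_add]
    ring
  smul_mem' := by
    rintro c a ⟨x, hx, y, hy, h⟩
    refine ⟨c • x, D.smul_mem c hx, c • y, D.smul_mem c hy, fun p => ?_⟩
    simp only [Pi.smul_apply, h p, smul_eq_mul, map_mul, Algebra.smul_def]
    ring

/-- `B` is the self-orthogonal additive code of a quantum Reed–Solomon code with parameters
`[[m n, m (n - 2k)]]`, `n = 2^m - 1`: it is `ω 𝓑(C_RS) + ω̄ 𝓑(C_RS)` for the binary expansion of a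
Reed–Solomon code of dimension `k ≤ 2^(m-1) - 1` with respect to a self-dual basis. The `n`
blocks of `𝔽₄^m` are indexed by the first coordinate. -/
def IsQuantumRS (m k : ℕ) (B : AdditiveCode (Fin (2 ^ m - 1) × Fin m)) : Prop :=
  1 ≤ k ∧ k ≤ 2 ^ (m - 1) - 1 ∧
  ∃ (ω : F4) (α : GaloisField 2 m) (b : Module.Basis (Fin m) (ZMod 2) (GaloisField 2 m)),
    ω ^ 2 = ω + 1 ∧
    IsPrimitiveRoot α (2 ^ m - 1) ∧
    (∀ i j, Algebra.trace (ZMod 2) (GaloisField 2 m) (b i * b j) = if i = j then 1 else 0) ∧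
    B = omegaSum ω (binaryExpansion b (rsCode m k α))

/-! ## Generalized concatenated quantum codes -/

/-- The vectors of `𝔽₄^{sm}`, viewed as `s` blocks of length `m`, whose blocks after the `j`-th one
vanish. -/
def firstBlocks {s m : ℕ} (j : Fin s) : AdditiveCode (Fin s × Fin m) where
  carrier := {u | ∀ p, j < p.1 → u p = 0}
  zero_mem' := by intro p _; rfl
  add_mem' := by
    intro a b ha hb p hp
    simp [ha p hp, hb p hp]
  smul_mem' := by
    intro c a ha p hp
    simp [ha p hp]

/-- The data from which a generalized concatenated quantum code of order `s` is built. The indices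
`1, …, s` are shifted to `0, …, s - 1`. -/
structure Construction (s : ℕ) where
  /-- the order is at least two -/
  two_le : 2 ≤ s
  /-- the outer codes have length `2^m - 1` over an alphabet of size `4^m` -/
  m : ℕ
  /-- the length of the inner codes -/
  n₂ : ℕ
  /-- the outer code `Q₁⁽ⁱ⁾` has parameters `[[m n₁, m (n₁ - 2 kᵢ)]]`, `n₁ = 2^m - 1` -/
  k : Fin s → ℕ
  /-- the additive codes of the outer codes -/
  B : Fin s → AdditiveCode (Fin (2 ^ m - 1) × Fin m)
  /-- the outer codes are quantum Reed–Solomon codes -/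
  outer : ∀ i, IsQuantumRS m (k i) (B i)
  /-- the additive codes of the inner codes -/
  C : Fin s → AdditiveCode (Fin n₂)
  /-- the inner codes are quantum codes -/
  inner_selfOrthogonal : ∀ j, IsSelfOrthogonal (C j)
  /-- the `j`-th inner code has `2^(n₂ - j m)` elements, `1 ≤ j ≤ s` -/
  inner_dim : ∀ j, Module.finrank (ZMod 2) (C j) + ((j : ℕ) + 1) * m = n₂
  /-- the inner codes are nested, `C_s ⊆ ⋯ ⊆ C_1` -/
  inner_nested : ∀ i j, i ≤ j → C j ≤ C i
  /-- a linear choice of representatives of a map `𝔽₄^{sm} → C_s^⊥ / C_s` -/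
  ρ : (Fin s × Fin m → F4) →ₗ[ZMod 2] (Fin n₂ → F4)
  /-- `ρ` preserves the inner product -/
  ρ_inner : ∀ u v, traceInner (ρ u) (ρ v) = traceInner u v
  /-- `C_j^⊥` is spanned by `C_j` and the images of the first `j` blocks; for `j = s` this says
  that `ρ` maps onto `C_s^⊥ / C_s` -/
  ρ_blocks : ∀ j, traceDual (C j) = C j ⊔ (firstBlocks j).map ρ

namespace Construction

variable {s : ℕ} (Q : Construction s)

/-- The length `n₁` of the outer codes as block codes. -/
abbrev n₁ : ℕ := 2 ^ Q.m - 1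

/-- The smallest inner code `C_s`. -/
def lastInner : AdditiveCode (Fin Q.n₂) := Q.C ⟨s - 1, by have := Q.two_le; omega⟩

/-- The additive code of the generalized concatenated quantum code: it consists of all
`(ρ(c_1) + u_1, …, ρ(c_{n₁}) + u_{n₁})`, where `c_l` is the `l`-th column of an element
`b = (b_1, …, b_s)` of `B_1 ⊕ ⋯ ⊕ B_s` (an `s × n₁` matrix over `𝔽₄^m`) and `u_l ∈ C_s`. -/
def code : AdditiveCode (Fin Q.n₁ × Fin Q.n₂) where
  carrier := {w | ∃ b : Fin s → (Fin Q.n₁ × Fin Q.m → F4), (∀ i, b i ∈ Q.B i) ∧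
    ∃ u : Fin Q.n₁ → (Fin Q.n₂ → F4), (∀ l, u l ∈ Q.lastInner) ∧
      ∀ l t, w (l, t) = Q.ρ (fun p => b p.1 (l, p.2)) t + u l t}
  zero_mem' := by
    refine ⟨0, fun i => (Q.B i).zero_mem, 0, fun l => Q.lastInner.zero_mem, fun l t => ?_⟩
    have : (fun p : Fin s × Fin Q.m =>
        (0 : Fin s → (Fin Q.n₁ × Fin Q.m → F4)) p.1 (l, p.2)) = 0 := rfl
    rw [this, map_zero]
    simp
  add_mem' := by
    rintro w w' ⟨b, hb, u, hu, h⟩ ⟨b', hb', u', hu', h'⟩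
    refine ⟨b + b', fun i => (Q.B i).add_mem (hb i) (hb' i), u + u',
      fun l => Q.lastInner.add_mem (hu l) (hu' l), fun l t => ?_⟩
    have : (fun p : Fin s × Fin Q.m => (b + b') p.1 (l, p.2)) =
        (fun p : Fin s × Fin Q.m => b p.1 (l, p.2)) + (fun p => b' p.1 (l, p.2)) := rfl
    rw [this, map_add]
    simp only [Pi.add_apply, h l t, h' l t]
    ring
  smul_mem' := by
    rintro c w ⟨b, hb, u, hu, h⟩
    refine ⟨c • b, fun i => (Q.B i).smul_mem c (hb i), c • u,
      fun l => Q.lastInner.smul_mem c (hu l), fun l t => ?_⟩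
    have : (fun p : Fin s × Fin Q.m => (c • b) p.1 (l, p.2)) =
        c • (fun p : Fin s × Fin Q.m => b p.1 (l, p.2)) := rfl
    rw [this, map_smul]
    simp only [Pi.smul_apply, h l t, smul_add]

/-- The length `n₁ n₂` (number of qubits) of the generalized concatenated quantum code. -/
def length : ℕ := Q.n₁ * Q.n₂

end Construction

/-- The rate expression `r - (r/s) ∑_{j=1}^s δ / H₄⁻¹((1 - r j / s) / 2)`. -/
def rateExpr (s : ℕ) (δ r : ℝ) : ℝ :=
  r - r / s * ∑ j ∈ Finset.Icc 1 s, δ / H4inv (1 / 2 * (1 - r * (j : ℝ) / s))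

end GCQ

end

noncomputable section

namespace GCQ

/-! ## The entropy function and the rate expression -/

/-! Existence of the codes. The inner codes come from a symplectic Gilbert–Varshamov argument. A
standard nested chain, made of the binary vectors supported on a tail of the coordinates, is moved
by an isometry of the trace form. The isometries act transitively on nonzero vectors (products of
two transvections suffice), so by counting some isometry moves all the duals `C_j^⊥`, of size
`2^(n₂+jm)`, off prescribed sets `W_j` as soon as `∑ |C_j^⊥| |W_j| < 4^n₂ - 1`
(`exists_nested_avoiding`). With Hamming balls for `W_j`, of size at most `4^(n₂ H₄(x_j))`, and `n₂
≈ sm/r`, every choice of radii with `H₄(x_j) < (1 - rj/s)/2` works for large `m`.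

The outer Reed–Solomon codes are MDS, so a nonzero vector of `B_j^⊥` has more than `k_j` nonzero
blocks. A vector of the dual of the concatenated code outside the code comes from some `b_i ∈
B_i^⊥`, not all zero. If `j` is the last index with `b_j ≠ 0`, more than `k_j` of its blocks are
nonzero elements of `C_j^⊥`, so its weight is at least `(k_j + 1) x_j n₂`
(`le_hammingNorm_of_mem_traceDual`). Taking `k_j = ⌊δ n₁ / (2 x_j)⌋` makes this at least `(δ/2) n₁
n₂` for every `j`, while the rate `(m/n₂)(s - ∑ 2k_j/n₁)` tends to `r - (r/s) ∑ δ/x_j`. Letting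
`x_j` increase to `H₄⁻¹((1 - rj/s)/2)` gives the rate expression.

Existence of the maximum on the open interval. The expression is continuous on the closed interval,
vanishes at `0` and is positive at the right endpoint `1 - 2H₄(δ)`. The endpoint is no better than a
certain interior point, because `u / H₄⁻¹((1 - u)/2)` is convex (`rateExpr_endpoint_le`); this in
turn rests on the convexity of `z ↦ H₄(1/z)` for `z > 2`. -/

theorem H4_zero : H4 0 = 0 := by simp [H4]

theorem H4_strictMonoOn : StrictMonoOn H4 (Set.Icc 0 (3 / 4)) := by
  have h := Real.qaryEntropy_strictMonoOn (q := 4) (by norm_num)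
  have e : (1 - 1 / ((4 : ℕ) : ℝ)) = 3 / 4 := by norm_num
  rw [e] at h
  intro x hx y hy hxy
  exact div_lt_div_of_pos_right (h hx hy hxy) (Real.log_pos (by norm_num))

theorem H4inv_mem {a : ℝ} (ha : a ∈ Set.Icc (0 : ℝ) 1) : H4inv a ∈ Set.Icc (0 : ℝ) (3 / 4) :=
  Function.invFunOn_mem (surjOn_H4 ha)

theorem H4_H4inv {a : ℝ} (ha : a ∈ Set.Icc (0 : ℝ) 1) : H4 (H4inv a) = a :=
  Function.invFunOn_eq (surjOn_H4 ha)

theorem H4_mem_Icc {x : ℝ} (hx : x ∈ Set.Icc (0 : ℝ) (3 / 4)) :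
    H4 x ∈ Set.Icc (0 : ℝ) 1 := by
  have h1 : H4 (3 / 4) = 1 := by
    have e : (1 - 3 / 4 : ℝ) = 4⁻¹ := by norm_num
    have e' : (3 / 4 / 3 : ℝ) = 4⁻¹ := by norm_num
    rw [H4_eq (by norm_num), e, e', Real.logb_inv, Real.logb_self_eq_one (by norm_num)]
    norm_num
  constructor
  · rw [← H4_zero]
    exact H4_strictMonoOn.monotoneOn (by norm_num) hx hx.1
  · rw [← h1]
    exact H4_strictMonoOn.monotoneOn hx (by norm_num) hx.2

theorem H4inv_H4 {x : ℝ} (hx : x ∈ Set.Icc (0 : ℝ) (3 / 4)) : H4inv (H4 x) = x :=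
  H4_strictMonoOn.injOn (H4inv_mem (H4_mem_Icc hx)) hx
    (H4_H4inv (H4_mem_Icc hx))

theorem H4inv_strictMonoOn : StrictMonoOn H4inv (Set.Icc 0 1) := by
  intro a ha b hb hab
  rw [← H4_strictMonoOn.lt_iff_lt (H4inv_mem ha) (H4inv_mem hb), H4_H4inv ha, H4_H4inv hb]
  exact hab

theorem H4inv_pos {a : ℝ} (ha : 0 < a) (ha' : a ≤ 1) : 0 < H4inv a := by
  have h := H4inv_strictMonoOn (by norm_num : (0 : ℝ) ∈ Set.Icc (0 : ℝ) 1) ⟨ha.le, ha'⟩ ha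
  exact (H4inv_mem (by norm_num : (0 : ℝ) ∈ Set.Icc (0 : ℝ) 1)).1.trans_lt h

theorem H4_mul_log {x : ℝ} (hx : 0 < x) :
    H4 x * Real.log 4 = x * (Real.log 3 - Real.log x) - (1 - x) * Real.log (1 - x) := by
  have h4 : Real.log 4 ≠ 0 := (Real.log_pos (by norm_num)).ne'
  rw [H4_eq hx, Real.logb, Real.logb, Real.log_div hx.ne' (by norm_num)]
  field_simp
  ring

/-- This places `H₄⁻¹((1 - u)/2)` below `1/2` for `u ≥ 0`, hence its reciprocal in the range `z >
2`, where convexity of `H₄(1/z)` has a short proof. -/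
theorem half_lt_H4_half : 1 / 2 < H4 (1 / 2) := by
  have h4 : 0 < Real.log 4 := Real.log_pos (by norm_num)
  have h := H4_mul_log (x := 1 / 2) (by norm_num)
  have e4 : Real.log 4 = 2 * Real.log 2 := by
    rw [show (4 : ℝ) = 2 ^ 2 by norm_num, Real.log_pow]; norm_num
  have e2 : Real.log (1 / 2) = - Real.log 2 := by rw [one_div, Real.log_inv]
  have h3 : 0 < Real.log 3 := Real.log_pos (by norm_num)
  have e12 : (1 - 1 / 2 : ℝ) = 1 / 2 := by norm_num
  rw [e12, e2] at h
  nlinarith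

/-! ### Convexity of the reciprocal of the inverse entropy -/

theorem H4_one_div_mul_log {z : ℝ} (hz : 1 < z) :
    H4 (1 / z) * Real.log 4 =
      Real.log 3 / z + Real.log z - Real.log (z - 1) + Real.log (z - 1) / z := by
  have hz0 : 0 < z := by linarith
  rw [H4_mul_log (by positivity)]
  have e : 1 - 1 / z = (z - 1) / z := by field_simp
  rw [e, Real.log_div (sub_pos.2 hz).ne' hz0.ne', Real.log_div one_ne_zero hz0.ne', Real.log_one]
  field_simp
  ring

/-- Up to the factor `log 4`, the second derivative is `(2 (log 3 + log (z-1)) - z/(z-1)) / z³`. For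
`z > 2` it is positive, since `log 3 > 1`, `log (z-1) > 0` and `z/(z-1) < 2`. -/
theorem convexOn_H4_one_div : ConvexOn ℝ (Set.Ioi (2 : ℝ)) (fun z => H4 (1 / z)) := by
  have h4 : 0 < Real.log 4 := Real.log_pos (by norm_num)
  have h3 : 1 < Real.log 3 := by
    rw [Real.lt_log_iff_exp_lt (by norm_num)]
    exact Real.exp_one_lt_d9.trans (by norm_num)
  have key : ConvexOn ℝ (Set.Ioi (2 : ℝ)) (fun z =>
      Real.log 3 / z + Real.log z - Real.log (z - 1) + Real.log (z - 1) / z) := by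
    have hd : ∀ z ∈ Set.Ioi (2 : ℝ), HasDerivAt (fun z =>
        Real.log 3 / z + Real.log z - Real.log (z - 1) + Real.log (z - 1) / z)
        (-(Real.log 3 + Real.log (z - 1)) / z ^ 2) z := by
      intro z hz
      have hz : 2 < z := hz
      have hz0 : z ≠ 0 := by linarith
      have hz1 : z - 1 ≠ 0 := by linarith
      have d1 : HasDerivAt (fun z : ℝ => Real.log (z - 1)) (1 / (z - 1)) z :=
        ((hasDerivAt_id z).sub_const 1).log hz1
      have d2 := Real.hasDerivAt_log hz0
      have d3 := (hasDerivAt_const z (Real.log 3)).div (hasDerivAt_id z) hz0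
      have d4 := d1.div (hasDerivAt_id z) hz0
      refine (((d3.add d2).sub d1).add d4).congr_deriv ?_
      simp only [id]
      field_simp
      ring
    have hd' : ∀ z ∈ Set.Ioi (2 : ℝ), HasDerivAt (fun z =>
        -(Real.log 3 + Real.log (z - 1)) / z ^ 2)
        ((2 * (Real.log 3 + Real.log (z - 1)) - z / (z - 1)) / z ^ 3) z := by
      intro z hz
      have hz : 2 < z := hz
      have hz0 : z ≠ 0 := by linarith
      have hz1 : z - 1 ≠ 0 := by linarith
      have d1 : HasDerivAt (fun z : ℝ => Real.log (z - 1)) (1 / (z - 1)) z :=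
        ((hasDerivAt_id z).sub_const 1).log hz1
      have d2 := (d1.const_add (Real.log 3)).neg
      refine (d2.div (hasDerivAt_pow 2 z) (by positivity)).congr_deriv ?_
      simp
      field_simp
      ring
    refine convexOn_of_hasDerivWithinAt2_nonneg (convex_Ioi 2)
      (fun z hz => (hd z hz).continuousAt.continuousWithinAt)
      (fun z hz => (hd z (interior_subset hz)).hasDerivWithinAt)
      (fun z hz => (hd' z (interior_subset hz)).hasDerivWithinAt) ?_
    intro z hz
    have hz : 2 < z := interior_subset hz
    have l1 : 0 < Real.log (z - 1) := Real.log_pos (by linarith)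
    have l2 : z / (z - 1) < 2 := by rw [div_lt_iff₀ (by linarith)]; linarith
    have : 0 < z ^ 3 := by positivity
    exact div_nonneg (by linarith) this.le
  have := key.smul (c := 1 / Real.log 4) (by positivity)
  refine this.congr ?_
  intro z hz
  have hz : 2 < z := hz
  simp only [smul_eq_mul]
  rw [← H4_one_div_mul_log (by linarith)]
  field_simp

theorem H4_le_one {x : ℝ} (hx : 0 ≤ x) (hx' : x ≤ 3 / 4) : H4 x ≤ 1 :=
  (H4_mem_Icc ⟨hx, hx'⟩).2

theorem one_div_H4inv_mem {a : ℝ} (ha : a ∈ Set.Ioo 0 (H4 (1 / 2))) :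
    0 < H4inv a ∧ 2 < 1 / H4inv a := by
  have h1 : H4 (1 / 2) ≤ 1 := H4_le_one (by norm_num) (by norm_num)
  have hp : 0 < H4inv a := H4inv_pos ha.1 (ha.2.le.trans h1)
  refine ⟨hp, ?_⟩
  have := H4inv_strictMonoOn ⟨ha.1.le, ha.2.le.trans h1⟩
    ⟨(ha.1.trans ha.2).le, h1⟩ ha.2
  rw [H4inv_H4 (by norm_num)] at this
  rw [lt_div_iff₀ hp]
  linarith

/-- The function is the inverse of the decreasing convex function `z ↦ H₄(1/z)`, and such an inverse
is again convex. -/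
theorem convexOn_one_div_H4inv :
    ConvexOn ℝ (Set.Ioo 0 (H4 (1 / 2))) (fun a => 1 / H4inv a) := by
  refine ⟨convex_Ioo _ _, ?_⟩
  intro a ha b hb t u ht hu htu
  have h1 : H4 (1 / 2) ≤ 1 := H4_le_one (by norm_num) (by norm_num)
  have hc : t • a + u • b ∈ Set.Ioo 0 (H4 (1 / 2)) := convex_Ioo _ _ ha hb ht hu htu
  have e : ∀ {c}, c ∈ Set.Ioo 0 (H4 (1 / 2)) → H4 (1 / (1 / H4inv c)) = c := by
    intro c hc
    rw [one_div_one_div, H4_H4inv ⟨hc.1.le, hc.2.le.trans h1⟩]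
  have key := convexOn_H4_one_div.2 (one_div_H4inv_mem ha).2 (one_div_H4inv_mem hb).2 ht hu htu
  simp only [e ha, e hb] at key
  have hz : 2 < t • (1 / H4inv a) + u • (1 / H4inv b) :=
    convex_Ioi (2 : ℝ) (one_div_H4inv_mem ha).2 (one_div_H4inv_mem hb).2 ht hu htu
  set z := t • (1 / H4inv a) + u • (1 / H4inv b)
  have hzi : 1 / z ∈ Set.Icc (0 : ℝ) (3 / 4) := by
    refine ⟨by positivity, ?_⟩
    rw [div_le_iff₀ (by linarith)]; linarith
  have := (H4inv_strictMonoOn.le_iff_le (H4_mem_Icc hzi)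
    ⟨hc.1.le, hc.2.le.trans h1⟩).2 key
  rw [H4inv_H4 hzi] at this
  rw [div_le_comm₀ (one_div_H4inv_mem hc).1 (by linarith)]
  exact this

theorem half_one_sub_mem {u : ℝ} (hu : u ∈ Set.Ico (0 : ℝ) 1) :
    1 / 2 * (1 - u) ∈ Set.Ioo 0 (H4 (1 / 2)) := by
  have := half_lt_H4_half
  exact ⟨by linarith [hu.2], by linarith [hu.1]⟩

theorem convexOn_one_div_H4inv_half :
    ConvexOn ℝ (Set.Ico (0 : ℝ) 1) (fun u => 1 / H4inv (1 / 2 * (1 - u))) := by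
  refine ⟨convex_Ico _ _, ?_⟩
  intro a ha b hb t u ht hu htu
  have := convexOn_one_div_H4inv.2 (half_one_sub_mem ha) (half_one_sub_mem hb) ht hu htu
  have e : t • (1 / 2 * (1 - a)) + u • (1 / 2 * (1 - b)) = 1 / 2 * (1 - (t • a + u • b)) := by
    simp only [smul_eq_mul]
    linear_combination (1 / 2) * htu
  rwa [e] at this

theorem continuousOn_one_div_H4inv_half :
    ContinuousOn (fun u : ℝ => 1 / H4inv (1 / 2 * (1 - u))) (Set.Ico 0 1) :=
  (convexOn_one_div_H4inv.continuousOn isOpen_Ioo).comp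
    (f := fun u : ℝ => 1 / 2 * (1 - u)) (by fun_prop) fun _ hu => half_one_sub_mem hu

theorem monotoneOn_one_div_H4inv_half :
    MonotoneOn (fun u : ℝ => 1 / H4inv (1 / 2 * (1 - u))) (Set.Ico 0 1) := by
  intro a ha b hb hab
  have hb' := half_one_sub_mem hb
  refine one_div_le_one_div_of_le (one_div_H4inv_mem hb').1 ?_
  exact H4inv_strictMonoOn.monotoneOn ⟨by linarith [hb.2], by linarith [hb.1]⟩
    ⟨by linarith [ha.2], by linarith [ha.1]⟩ (by linarith)

/-- A product of two nonnegative increasing convex functions is convex. -/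
theorem convexOn_mul_one_div_H4inv_half :
    ConvexOn ℝ (Set.Ico (0 : ℝ) 1) (fun u => u * (1 / H4inv (1 / 2 * (1 - u)))) := by
  refine (convexOn_id (convex_Ico 0 1)).mul convexOn_one_div_H4inv_half (fun x hx => hx.1)
    (fun x hx => (one_div_pos.2 (one_div_H4inv_mem (half_one_sub_mem hx)).1).le) ?_
  exact monotoneOn_id.monovaryOn monotoneOn_one_div_H4inv_half

/-! ### The maximum of the rate expression -/

theorem rateExpr_eq (s : ℕ) (δ r : ℝ) :
    rateExpr s δ r = r - r / s * ∑ j ∈ Finset.Icc 1 s,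
      δ * (1 / H4inv (1 / 2 * (1 - r * (j : ℝ) / s))) := by
  simp only [rateExpr, mul_one_div]

theorem mul_div_mem_Ico {s j : ℕ} (hj : j ≤ s) {r : ℝ} (hr : 0 ≤ r) (hr1 : r < 1) :
    r * (j : ℝ) / s ∈ Set.Ico (0 : ℝ) 1 := by
  refine ⟨by positivity, ?_⟩
  rcases Nat.eq_zero_or_pos s with rfl | hs
  · simp
  · have hs' : (0 : ℝ) < s := by exact_mod_cast hs
    have hj' : (j : ℝ) ≤ s := by exact_mod_cast hj
    rw [div_lt_one hs']
    nlinarith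

theorem mul_div_le {s j : ℕ} (hj : j ≤ s) {r : ℝ} (hr : 0 ≤ r) : r * (j : ℝ) / s ≤ r := by
  rcases Nat.eq_zero_or_pos s with rfl | hs
  · simpa using hr
  · have hs' : (0 : ℝ) < s := by exact_mod_cast hs
    have hj' : (j : ℝ) ≤ s := by exact_mod_cast hj
    rw [div_le_iff₀ hs']
    nlinarith

theorem H4_bounds_of_lt {δ : ℝ} (hδ₀ : 0 < δ) (hδ₁ : δ < H4inv (1 / 2)) :
    δ ∈ Set.Icc (0 : ℝ) (3 / 4) ∧ 0 < H4 δ ∧ H4 δ < 1 / 2 := by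
  have hm := H4inv_mem (a := 1 / 2) (by norm_num)
  have hδ : δ ∈ Set.Icc (0 : ℝ) (3 / 4) := ⟨hδ₀.le, hδ₁.le.trans hm.2⟩
  refine ⟨hδ, ?_, ?_⟩
  · have := H4_strictMonoOn (by norm_num) hδ hδ₀
    rwa [H4_zero] at this
  · have := H4_strictMonoOn hδ hm hδ₁
    rwa [H4_H4inv (by norm_num)] at this

/-- `δ < H₄⁻¹((1 - u) / 2)` for all `u < 1 - 2 H₄(δ)`. -/
theorem lt_H4inv_half_one_sub {δ : ℝ} (hδ₀ : 0 < δ) (hδ₁ : δ < H4inv (1 / 2)) {u : ℝ} (hu : 0 ≤ u)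
    (hu' : u < 1 - 2 * H4 δ) : δ < H4inv (1 / 2 * (1 - u)) := by
  obtain ⟨h1, h2, h3⟩ := H4_bounds_of_lt hδ₀ hδ₁
  have := H4inv_strictMonoOn (H4_mem_Icc h1) (b := 1 / 2 * (1 - u))
    ⟨by linarith, by linarith⟩ (by linarith)
  rwa [H4inv_H4 h1] at this

theorem continuousOn_rateExpr {s : ℕ} {δ : ℝ} :
    ContinuousOn (rateExpr s δ) (Set.Ico 0 1) := by
  have : rateExpr s δ = fun r => r - r / s * ∑ j ∈ Finset.Icc 1 s,
      δ * (1 / H4inv (1 / 2 * (1 - r * (j : ℝ) / s))) := funext (rateExpr_eq s δ)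
  rw [this]
  refine continuousOn_id.sub (ContinuousOn.mul (by fun_prop) (continuousOn_finsetSum _ ?_))
  intro j hj
  refine continuousOn_const.mul ?_
  exact continuousOn_one_div_H4inv_half.comp (f := fun r : ℝ => r * (j : ℝ) / s) (by fun_prop)
    fun r hr => mul_div_mem_Ico (Finset.mem_Icc.1 hj).2 hr.1 hr.2

/-- With `G(u) = u / H₄⁻¹((1-u)/2)` the rate expression is `x - δ ∑_j G(xj/s)/j`. Passing from `R`
to `r = R(s-1)/s` costs `R/s` in the first term. Convexity of `G` bounds the gain in the sum below
by a telescoping sum, of total `(G(R) - G(0))/s = R/(δs)`, which compensates exactly. -/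
theorem rateExpr_endpoint_le {s : ℕ} (hs : 2 ≤ s) {δ : ℝ} (hδ₀ : 0 < δ)
    (hδ₁ : δ < H4inv (1 / 2)) :
    rateExpr s δ (1 - 2 * H4 δ) ≤
      rateExpr s δ ((1 - 2 * H4 δ) * ((s - 1 : ℕ) : ℝ) / s) := by
  obtain ⟨hm, hH0, hH1⟩ := H4_bounds_of_lt hδ₀ hδ₁
  set R := 1 - 2 * H4 δ with hR
  have hs0 : (0 : ℝ) < s := by exact_mod_cast (by omega : 0 < s)
  have hs1 : ((s - 1 : ℕ) : ℝ) = s - 1 := by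
    rw [Nat.cast_sub (by omega : 1 ≤ s), Nat.cast_one]
  set r := R * ((s - 1 : ℕ) : ℝ) / s with hr
  set G : ℝ → ℝ := fun u => u * (1 / H4inv (1 / 2 * (1 - u))) with hG
  have hf : ∀ x, rateExpr s δ x = x - δ * ∑ j ∈ Finset.range s,
      1 / ((j : ℝ) + 1) * G (x * ((j : ℝ) + 1) / s) := by
    intro x
    rw [rateExpr_eq, Finset.range_eq_Ico, Finset.sum_Ico_add' (fun j : ℕ => (1 / (j : ℝ)) *
      G (x * (j : ℝ) / s)) 0 s 1 |>.symm.trans (Finset.sum_congr rfl fun j _ => by push_cast; rfl)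
      |>.symm]
    rw [show Finset.Ico (0 + 1) (s + 1) = Finset.Icc 1 s by
      ext; simp only [Finset.mem_Ico, Finset.mem_Icc]; omega]
    rw [Finset.mul_sum, Finset.mul_sum]
    congr 1
    refine Finset.sum_congr rfl fun j hj => ?_
    have : (0 : ℝ) < j := by exact_mod_cast (Finset.mem_Icc.1 hj).1
    simp only [hG]
    field_simp
  -- With `i = j + 1`, the point `ri/s` is the convex combination of `R(i-1)/s` and `Ri/s` with
  -- weights `i/s` and `1 - i/s`. Dividing the convexity inequality by `i` gives a bound whose
  -- left-hand sides telescope.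
  have hstep : ∀ j ∈ Finset.range s, 1 / (s : ℝ) * (G (R * ((j + 1 : ℕ) : ℝ) / s) -
      G (R * (j : ℝ) / s)) ≤ 1 / ((j : ℝ) + 1) * G (R * ((j : ℝ) + 1) / s) -
        1 / ((j : ℝ) + 1) * G (r * ((j : ℝ) + 1) / s) := by
    intro j hj
    have hj := Finset.mem_range.1 hj
    have hj1 : ((j : ℝ) + 1) ≤ s := by exact_mod_cast hj
    have h := convexOn_mul_one_div_H4inv_half.2
      (mul_div_mem_Ico (s := s) (j := j) (by omega) (r := R) (by linarith) (by linarith))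
      (mul_div_mem_Ico (s := s) (j := j + 1) (by omega) (r := R) (by linarith) (by linarith))
      (by positivity : (0 : ℝ) ≤ ((j : ℝ) + 1) / s)
      (by rw [sub_nonneg, div_le_one hs0]; exact hj1 : 0 ≤ 1 - ((j : ℝ) + 1) / s) (by ring)
    have e : (((j : ℝ) + 1) / s) • (R * (j : ℝ) / s) + (1 - ((j : ℝ) + 1) / s) •
        (R * ((j + 1 : ℕ) : ℝ) / s) = r * ((j : ℝ) + 1) / s := by
      simp only [smul_eq_mul, hr, hs1]
      push_cast
      field_simp
      ring
    rw [e] at h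
    change G (r * ((j : ℝ) + 1) / s) ≤ ((j : ℝ) + 1) / s * G (R * (j : ℝ) / s) +
      (1 - ((j : ℝ) + 1) / s) * G (R * ((j + 1 : ℕ) : ℝ) / s) at h
    push_cast at h ⊢
    set A := G (r * ((j : ℝ) + 1) / s)
    set B := G (R * (j : ℝ) / s)
    set D := G (R * ((j : ℝ) + 1) / s)
    have hj0 : (0 : ℝ) < (j : ℝ) + 1 := by positivity
    have h' := mul_le_mul_of_nonneg_left h (by positivity : 0 ≤ 1 / ((j : ℝ) + 1))
    have e2 : 1 / ((j : ℝ) + 1) * (((j : ℝ) + 1) / s * B + (1 - ((j : ℝ) + 1) / s) * D) =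
      1 / s * B + 1 / ((j : ℝ) + 1) * D - 1 / s * D := by field_simp; ring
    rw [e2] at h'
    linarith
  have hsum := Finset.sum_le_sum hstep
  rw [← Finset.mul_sum, Finset.sum_range_sub (fun j : ℕ => G (R * (j : ℝ) / s)),
    Finset.sum_sub_distrib] at hsum
  have hGR : G (R * (s : ℝ) / s) = R / δ := by
    rw [mul_div_cancel_right₀ _ hs0.ne']
    simp only [hG]
    rw [show 1 / 2 * (1 - R) = H4 δ by rw [hR]; ring, H4inv_H4 hm]
    ring
  have hG0 : G (R * ((0 : ℕ) : ℝ) / s) = 0 := by simp [hG]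
  rw [hGR, hG0] at hsum
  have h2 := mul_le_mul_of_nonneg_left hsum hδ₀.le
  have e3 : δ * (1 / (s : ℝ) * (R / δ - 0)) = R / s := by field_simp; ring
  rw [e3] at h2
  have e4 : R - r = R / s := by rw [hr, hs1]; field_simp; ring
  rw [hf, hf]
  linarith

/-- Each of the `s` quotients in the sum is at most `1`, with equality at `j = s`. The quotient at
`j = 1` is smaller than `1` because `s ≥ 2`. -/
theorem rateExpr_endpoint_pos {s : ℕ} (hs : 2 ≤ s) {δ : ℝ} (hδ₀ : 0 < δ)
    (hδ₁ : δ < H4inv (1 / 2)) : 0 < rateExpr s δ (1 - 2 * H4 δ) := by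
  obtain ⟨hm, hH0, hH1⟩ := H4_bounds_of_lt hδ₀ hδ₁
  set R := 1 - 2 * H4 δ with hR
  have hs0 : (0 : ℝ) < s := by exact_mod_cast (by omega : 0 < s)
  have hlt : ∑ j ∈ Finset.Icc 1 s, δ / H4inv (1 / 2 * (1 - R * (j : ℝ) / s)) <
      ∑ j ∈ Finset.Icc 1 s, (1 : ℝ) := by
    refine Finset.sum_lt_sum ?_ ⟨1, Finset.mem_Icc.2 ⟨le_rfl, by omega⟩, ?_⟩
    · intro j hj
      have hj := (Finset.mem_Icc.1 hj).2
      have h1 := mul_div_le hj (r := R) (by linarith)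
      have hu := mul_div_mem_Ico hj (r := R) (by linarith) (by linarith)
      have hp := (one_div_H4inv_mem (half_one_sub_mem hu)).1
      rw [div_le_one hp]
      rcases h1.lt_or_eq with h | h
      · exact (lt_H4inv_half_one_sub hδ₀ hδ₁ hu.1 h).le
      · rw [h, show 1 / 2 * (1 - R) = H4 δ by rw [hR]; ring, H4inv_H4 hm]
    · have hu := mul_div_mem_Ico (s := s) (j := 1) (by omega) (r := R) (by linarith) (by linarith)
      have hp := (one_div_H4inv_mem (half_one_sub_mem hu)).1
      rw [div_lt_one hp]
      refine lt_H4inv_half_one_sub hδ₀ hδ₁ hu.1 ?_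
      have : (1 : ℝ) < s := by exact_mod_cast (by omega : 1 < s)
      rw [← hR, div_lt_iff₀ hs0]
      push_cast
      nlinarith
  simp only [Finset.sum_const, Nat.card_Icc, Nat.add_sub_cancel, nsmul_eq_mul, mul_one] at hlt
  have hRpos : 0 < R := by linarith
  have := mul_lt_mul_of_pos_left hlt (div_pos hRpos hs0)
  rw [div_mul_cancel₀ _ hs0.ne'] at this
  simp only [rateExpr]
  linarith

theorem exists_isMaxOn_rateExpr {s : ℕ} (hs : 2 ≤ s) {δ : ℝ} (hδ₀ : 0 < δ)
    (hδ₁ : δ < H4inv (1 / 2)) :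
    ∃ r ∈ Set.Ioo 0 (1 - 2 * H4 δ), IsMaxOn (rateExpr s δ) (Set.Ioo 0 (1 - 2 * H4 δ)) r := by
  obtain ⟨hm, hH0, hH1⟩ := H4_bounds_of_lt hδ₀ hδ₁
  have hpos := rateExpr_endpoint_pos hs hδ₀ hδ₁
  have hle := rateExpr_endpoint_le hs hδ₀ hδ₁
  set R := 1 - 2 * H4 δ with hR
  have hs0 : (0 : ℝ) < s := by exact_mod_cast (by omega : 0 < s)
  obtain ⟨r, hr, hmax⟩ := isCompact_Icc.exists_isMaxOn (s := Set.Icc 0 R)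
    ⟨0, by constructor <;> linarith⟩
    ((continuousOn_rateExpr (s := s) (δ := δ)).mono fun x hx => ⟨hx.1, by linarith [hx.2]⟩)
  have hmem : R * ((s - 1 : ℕ) : ℝ) / s ∈ Set.Ioo 0 R := by
    have : (1 : ℝ) ≤ ((s - 1 : ℕ) : ℝ) := by exact_mod_cast (by omega : 1 ≤ s - 1)
    have h2 : ((s - 1 : ℕ) : ℝ) < s := by exact_mod_cast (by omega : s - 1 < s)
    refine ⟨div_pos (mul_pos (by linarith) (by linarith)) hs0, ?_⟩
    rw [div_lt_iff₀ hs0]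
    exact mul_lt_mul_of_pos_left h2 (by linarith)
  have hmax' : ∀ x ∈ Set.Ioo 0 R, rateExpr s δ x ≤ rateExpr s δ r :=
    fun x hx => hmax ⟨hx.1.le, hx.2.le⟩
  -- The maximum over the compact interval is not at `0`, where the value is `0`. If it is at `R`,
  -- it is also attained at the interior point `R(s-1)/s`.
  rcases hr.2.lt_or_eq with h | rfl
  · refine ⟨r, ⟨lt_of_le_of_ne hr.1 ?_, h⟩, hmax'⟩
    rintro rfl
    have : rateExpr s δ R ≤ rateExpr s δ 0 := hmax ⟨by linarith, le_rfl⟩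
    simp only [rateExpr, zero_div, zero_mul, sub_zero] at this
    simp only [rateExpr] at hpos
    linarith
  · exact ⟨_, hmem, fun x hx => (hmax' x hx).trans hle⟩

/-! ## The trace form -/

theorem zmod_two_cases (c : ZMod 2) : c = 0 ∨ c = 1 := by
  revert c; decide

theorem F4.two_eq_zero : (2 : F4) = 0 := CharTwo.two_eq_zero

theorem F4.pow_four (x : F4) : x ^ 4 = x := by
  have := Fintype.ofFinite F4
  have h := FiniteField.pow_card x
  rw [← Nat.card_eq_fintype_card, GaloisField.card 2 2 (by norm_num)] at h
  simpa using h

theorem F4.add_self (x : F4) : x + x = 0 := CharTwo.add_self_eq_zero x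

theorem F4.exists_omega : ∃ ω : F4, ω ^ 2 = ω + 1 := by
  classical
  have hc : Nat.card F4 = 4 := by rw [GaloisField.card 2 2 (by norm_num)]; norm_num
  obtain ⟨x, hx⟩ : ∃ x : F4, x ∉ ({0, 1} : Finset F4) := by
    by_contra! h
    have := Fintype.ofFinite F4
    have h1 := Finset.card_le_card (fun x _ => h x : (Finset.univ : Finset F4) ⊆ {0, 1})
    rw [Finset.card_univ, ← Nat.card_eq_fintype_card, hc] at h1
    exact absurd (h1.trans Finset.card_le_two) (by norm_num)
  simp only [Finset.mem_insert, Finset.mem_singleton, not_or] at hx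
  refine ⟨x, ?_⟩
  have h : x * (x - 1) * (x ^ 2 - (x + 1)) = 0 := by
    linear_combination F4.pow_four x - x ^ 3 * F4.two_eq_zero + x * F4.two_eq_zero
  rcases mul_eq_zero.1 h with h | h
  · rcases mul_eq_zero.1 h with h | h
    · exact absurd h hx.1
    · exact absurd (sub_eq_zero.1 h) hx.2
  · exact sub_eq_zero.1 h

section TraceForm

variable {ι : Type} [Fintype ι]

theorem algebraMap_trace_F4 (x : F4) :
    algebraMap (ZMod 2) F4 (Algebra.trace (ZMod 2) F4 x) = x + x ^ 2 := by
  rw [FiniteField.algebraMap_trace_eq_sum_pow, GaloisField.finrank 2 (by norm_num)]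
  simp [Finset.sum_range_succ]

/-- The trace inner product as a bilinear form with values in `𝔽₂`. -/
def traceForm (ι : Type) [Fintype ι] : LinearMap.BilinForm (ZMod 2) (ι → F4) :=
  LinearMap.mk₂ (ZMod 2) (fun u v => ∑ i, Algebra.trace (ZMod 2) F4 (u i * v i ^ 2))
    (by intro a b v; simp [add_mul, Finset.sum_add_distrib])
    (by intro c a v; simp [Finset.mul_sum])
    (by
      intro u a b
      simp only [Pi.add_apply, ← Finset.sum_add_distrib]
      refine Finset.sum_congr rfl fun i _ => ?_
      rw [add_pow_char, mul_add, map_add])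
    (by
      intro c u v
      rcases zmod_two_cases c with rfl | rfl <;> simp)

theorem algebraMap_traceForm (u v : ι → F4) :
    algebraMap (ZMod 2) F4 (traceForm ι u v) = traceInner u v := by
  simp only [traceForm, LinearMap.mk₂_apply, map_sum, algebraMap_trace_F4, traceInner]
  refine Finset.sum_congr rfl fun i _ => ?_
  linear_combination u i ^ 2 * F4.pow_four (v i)

theorem traceForm_eq_zero_iff {u v : ι → F4} : traceForm ι u v = 0 ↔ traceInner u v = 0 := by
  rw [← algebraMap_traceForm]
  exact (map_eq_zero (algebraMap (ZMod 2) F4)).symm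

theorem traceForm_eq_iff {κ : Type} [Fintype κ] {u v : ι → F4} {u' v' : κ → F4} :
    traceForm ι u v = traceForm κ u' v' ↔ traceInner u v = traceInner u' v' := by
  rw [← algebraMap_traceForm, ← algebraMap_traceForm, (algebraMap (ZMod 2) F4).injective.eq_iff]

theorem traceForm_isAlt : (traceForm ι).IsAlt := by
  intro u
  rw [traceForm_eq_zero_iff]
  refine Finset.sum_eq_zero fun i _ => ?_
  linear_combination u i ^ 3 * F4.two_eq_zero

theorem traceForm_symm (u v : ι → F4) : traceForm ι u v = traceForm ι v u := by
  rw [traceForm_eq_iff]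
  refine Finset.sum_congr rfl fun i _ => by ring

theorem traceInner_comm (u v : ι → F4) : traceInner u v = traceInner v u :=
  traceForm_eq_iff.1 (traceForm_symm u v)

theorem traceInner_single [DecidableEq ι] (u : ι → F4) (i : ι) (x : F4) :
    traceInner u (Pi.single i x) = u i * x ^ 2 + u i ^ 2 * x := by
  rw [traceInner, Finset.sum_eq_single i]
  · simp
  · intro j _ hj
    simp [Pi.single_eq_of_ne hj]
  · simp

theorem eq_zero_of_traceInner_eq_zero {u : ι → F4} (h : ∀ v, traceInner u v = 0) : u = 0 := by
  classical
  obtain ⟨ω, hω⟩ := F4.exists_omega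
  funext i
  have h1 := h (Pi.single i 1)
  have h2 := h (Pi.single i ω)
  rw [traceInner_single] at h1 h2
  rw [Pi.zero_apply]
  have h3 : ω ^ 2 + ω = 1 := by linear_combination hω + ω * F4.two_eq_zero
  -- Testing against `1` and `ω` in coordinate `i` gives `u + u² = 0` and `ω²u + ωu² = 0`; `ω` times
  -- the first plus the second is `(ω + ω²)u = u`.
  linear_combination (ω) * h1 + h2 - (u i) * hω - (u i * ω + u i ^ 2 * ω) * F4.two_eq_zero

theorem traceForm_nondegenerate : (traceForm ι).Nondegenerate := by
  refine (LinearMap.IsRefl.nondegenerate_iff_separatingLeft traceForm_isAlt.isRefl).2 ?_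
  intro u h
  exact eq_zero_of_traceInner_eq_zero fun v => traceForm_eq_zero_iff.1 (h v)

theorem traceDual_eq_orthogonal (C : AdditiveCode ι) :
    traceDual C = (traceForm ι).orthogonal C := by
  ext u
  simp only [LinearMap.BilinForm.mem_orthogonal_iff]
  refine forall₂_congr fun v _ => ?_
  rw [traceForm_symm, traceForm_eq_zero_iff]

theorem finrank_traceDual (C : AdditiveCode ι) :
    Module.finrank (ZMod 2) (traceDual C) =
      2 * Fintype.card ι - Module.finrank (ZMod 2) C := by
  rw [traceDual_eq_orthogonal, LinearMap.BilinForm.finrank_orthogonal traceForm_nondegenerate]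
  congr 1
  rw [Module.finrank_pi_fintype]
  simp [GaloisField.finrank 2 (n := 2) (by norm_num), mul_comm]

end TraceForm

/-! ## Isometries of an alternating form over `𝔽₂` -/

section Isometry

variable {V : Type*} [AddCommGroup V] [Module (ZMod 2) V]

/-- The group of linear isometries of a bilinear form. -/
def isometryGroup (B : LinearMap.BilinForm (ZMod 2) V) : Subgroup (V ≃ₗ[ZMod 2] V) where
  carrier := {g | ∀ x y, B (g x) (g y) = B x y}
  one_mem' := fun _ _ => rfl
  mul_mem' := by
    intro g h hg hh x y
    rw [LinearEquiv.mul_apply, LinearEquiv.mul_apply, hg, hh]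
  inv_mem' := by
    intro g hg x y
    rw [← hg]
    simp [LinearEquiv.coe_inv]

theorem transvection_mem_isometryGroup {B : LinearMap.BilinForm (ZMod 2) V} (hB : B.IsAlt)
    (a : V) : LinearEquiv.transvection (f := B a) (v := a) (hB a) ∈ isometryGroup B := by
  intro x y
  simp only [LinearEquiv.transvection.apply, map_add, map_smul, LinearMap.add_apply,
    LinearMap.smul_apply, smul_eq_mul, hB a]
  rw [← hB.neg_eq x a]
  ring

theorem add_self_zmod_two (x : V) : x + x = 0 := by
  have : (2 : ZMod 2) • x = 0 := by rw [show (2 : ZMod 2) = 0 by decide, zero_smul]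
  rwa [two_smul] at this

/-- The transvection along `u + v` sends `u` to `u + B(u + v, u)(u + v) = u + (u + v) = v`. -/
theorem exists_isometry_of_apply_eq_one {B : LinearMap.BilinForm (ZMod 2) V} (hB : B.IsAlt)
    {u v : V} (h : B u v = 1) : ∃ g ∈ isometryGroup B, g u = v := by
  refine ⟨_, transvection_mem_isometryGroup hB (u + v), ?_⟩
  rw [LinearEquiv.transvection.apply, map_add, LinearMap.add_apply, hB u, zero_add,
    ← hB.neg_eq u v, h, show (-1 : ZMod 2) = 1 by decide, one_smul, ← add_assoc,
    add_self_zmod_two, zero_add]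

/-- If `w` pairs to `1` with both `u` and `v`, two transvections carry `u` to `w` and `w` to `v`.
Given `a` with `B(u,a) = 1` and `b` with `B(v,b) = 1`, one of `a`, `b`, `a + b` serves as `w`. -/
theorem exists_isometry {B : LinearMap.BilinForm (ZMod 2) V} (hB : B.IsAlt)
    (hn : ∀ u, (∀ v, B u v = 0) → u = 0) {u v : V} (hu : u ≠ 0) (hv : v ≠ 0) :
    ∃ g ∈ isometryGroup B, g u = v := by
  obtain ⟨a, ha⟩ : ∃ a, B u a ≠ 0 := by
    by_contra! h
    exact hu (hn u h)
  obtain ⟨b, hb⟩ : ∃ b, B v b ≠ 0 := by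
    by_contra! h
    exact hv (hn v h)
  have ha := (zmod_two_cases (B u a)).resolve_left ha
  have hb := (zmod_two_cases (B v b)).resolve_left hb
  obtain ⟨w, h1, h2⟩ : ∃ w, B u w = 1 ∧ B v w = 1 := by
    rcases zmod_two_cases (B v a) with h | h
    · rcases zmod_two_cases (B u b) with h' | h'
      · exact ⟨a + b, by simp [ha, h'], by simp [hb, h]⟩
      · exact ⟨b, h', hb⟩
    · exact ⟨a, ha, h⟩
  obtain ⟨g, hg, hgu⟩ := exists_isometry_of_apply_eq_one hB h1
  obtain ⟨k, hk, hkw⟩ := exists_isometry_of_apply_eq_one (B := B) (u := w) (v := v) hB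
    (by rw [← hB.neg_eq v w, h2]; decide)
  exact ⟨k * g, mul_mem hk hg, by rw [LinearEquiv.mul_apply, hgu, hkw]⟩

end Isometry

/-! ### A union bound over a transitive group action -/

section Averaging

variable {G X J : Type*} [Group G] [Fintype G] [MulAction G X] [DecidableEq X] [Fintype J]

open Finset in
-- If `h a' = a` and `k b = b'`, then `g ↦ k g h` is a bijection between the two sets of group
-- elements.
theorem card_filter_smul_eq {S : Finset X}
    (ht : ∀ a ∈ S, ∀ b ∈ S, ∃ g : G, g • a = b) {a b a' b' : X} (ha : a ∈ S) (hb : b ∈ S)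
    (ha' : a' ∈ S) (hb' : b' ∈ S) :
    #{g : G | g • a = b} = #{g : G | g • a' = b'} := by
  obtain ⟨h, hh⟩ := ht a' ha' a ha
  obtain ⟨k, hk⟩ := ht b hb b' hb'
  refine card_equiv ((Equiv.mulLeft k).trans (Equiv.mulRight h)) fun g => ?_
  simp only [mem_filter, mem_univ, true_and, Equiv.trans_apply, Equiv.coe_mulLeft,
    Equiv.coe_mulRight]
  rw [mul_smul, hh, mul_smul, ← hk]
  exact (smul_left_cancel_iff k).symm

open Finset in
/-- If a finite group acts transitively on `S`, then some group element moves each `A j` off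
`W j`, provided that `∑ |A j| |W j| < |S|`. -/
theorem exists_smul_notMem {S : Finset X} (hS : ∀ (g : G), ∀ a ∈ S, g • a ∈ S)
    (ht : ∀ a ∈ S, ∀ b ∈ S, ∃ g : G, g • a = b) (A W : J → Finset X) (hA : ∀ j, A j ⊆ S)
    (hW : ∀ j, W j ⊆ S) (hlt : ∑ j, #(A j) * #(W j) < #S) :
    ∃ g : G, ∀ j, ∀ a ∈ A j, g • a ∉ W j := by
  classical
  by_contra! hcon
  obtain ⟨a₀, ha₀⟩ : S.Nonempty := card_pos.1 (by omega)
  set c := #{g : G | g • a₀ = a₀} with hc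
  have hcc : ∀ a ∈ S, ∀ b ∈ S, #{g : G | g • a = b} = c :=
    fun a ha b hb => card_filter_smul_eq ht ha hb ha₀ ha₀
  have hcard : Fintype.card G = c * #S := by
    rw [← card_univ, card_eq_sum_card_fiberwise (f := fun g : G => g • a₀) (t := S)
      (fun g _ => hS g a₀ ha₀), sum_congr rfl (fun b hb => hcc a₀ ha₀ b hb), sum_const,
      smul_eq_mul, mul_comm]
  have hc0 : 0 < c := Nat.pos_of_ne_zero fun h => by
    rw [h, zero_mul] at hcard
    exact Fintype.card_ne_zero hcard
  -- If the claim fails, every `g` sends some element of some `A j` into `W j`. Each pair `(a, b)`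
  -- accounts for `c = |G|/|S|` elements, so `|G| ≤ c ∑ |A j| |W j| < c |S| = |G|`.
  have hcover : (univ : Finset G) ⊆ univ.biUnion fun j : J => (A j).biUnion fun a =>
      (W j).biUnion fun b => {g : G | g • a = b} := by
    intro g _
    obtain ⟨j, a, ha, hb⟩ := hcon g
    simp only [mem_biUnion, mem_filter, mem_univ, true_and]
    exact ⟨j, a, ha, _, hb, rfl⟩
  have h1 := card_le_card hcover
  rw [card_univ, hcard] at h1
  have h2 : c * #S ≤ ∑ j, #(A j) * (#(W j) * c) := by
    refine h1.trans (card_biUnion_le.trans (sum_le_sum fun j _ => ?_))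
    refine card_biUnion_le_card_mul _ _ _ fun a ha => ?_
    exact card_biUnion_le_card_mul _ _ _ fun b hb => (hcc a (hA j ha) b (hW j hb)).le
  simp only [← mul_assoc, ← sum_mul] at h2
  rw [mul_comm] at h2
  exact absurd (Nat.le_of_mul_le_mul_right h2 hc0) (by omega)

end Averaging

/-! ## Nested inner codes -/

instance : Fintype F4 := Fintype.ofFinite F4

theorem card_F4 : Fintype.card F4 = 4 := by
  rw [← Nat.card_eq_fintype_card, GaloisField.card 2 2 (by norm_num)]
  norm_num

theorem F4.exists_algebraMap_eq {x : F4} (h : x ^ 2 = x) :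
    ∃ c : ZMod 2, algebraMap (ZMod 2) F4 c = x := by
  have h' : x * (x - 1) = 0 := by linear_combination h
  rcases mul_eq_zero.1 h' with h | h
  · exact ⟨0, by rw [h, map_zero]⟩
  · exact ⟨1, by rw [sub_eq_zero.1 h, map_one]⟩

/-- The binary vectors of length `n` whose first `d` coordinates vanish. -/
def binaryTail (n d : ℕ) : AdditiveCode (Fin n) where
  carrier := {v | ∀ t : Fin n, ((t : ℕ) < d → v t = 0) ∧ v t ^ 2 = v t}
  zero_mem' := by intro t; simp
  add_mem' := by
    intro a b ha hb t
    refine ⟨fun h => ?_, ?_⟩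
    · rw [Pi.add_apply, (ha t).1 h, (hb t).1 h, add_zero]
    · rw [Pi.add_apply, add_pow_char, (ha t).2, (hb t).2]
  smul_mem' := by
    intro c a ha t
    rcases zmod_two_cases c with rfl | rfl
    · simp
    · simpa using ha t

theorem finrank_binaryTail (n d : ℕ) : Module.finrank (ZMod 2) (binaryTail n d) = n - d := by
  let φ : (Fin (n - d) → ZMod 2) →ₗ[ZMod 2] (Fin n → F4) :=
    { toFun := fun x t =>
        if h : d ≤ (t : ℕ) then algebraMap (ZMod 2) F4 (x ⟨t - d, by omega⟩) else 0
      map_add' := by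
        intro x y
        funext t
        by_cases h : d ≤ (t : ℕ) <;> simp [h]
      map_smul' := by
        intro c x
        funext t
        by_cases h : d ≤ (t : ℕ) <;> simp [h, Algebra.smul_def] }
  have hφ : ∀ (x) (i : Fin (n - d)), φ x ⟨d + i, by omega⟩ = algebraMap (ZMod 2) F4 (x i) := by
    intro x i
    simp [φ]
  have hinj : Function.Injective φ := by
    intro x y hxy
    funext i
    apply (algebraMap (ZMod 2) F4).injective
    rw [← hφ, ← hφ, hxy]
  have hrange : LinearMap.range φ = binaryTail n d := by
    ext v
    constructor
    · rintro ⟨x, rfl⟩ t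
      refine ⟨fun h => ?_, ?_⟩
      · simp [φ, not_le.2 h]
      · by_cases h : d ≤ (t : ℕ)
        · simp only [φ, LinearMap.coe_mk, AddHom.coe_mk, dif_pos h, ← map_pow, ZMod.pow_card]
        · simp [φ, h]
    · intro hv
      choose c hc using fun t => F4.exists_algebraMap_eq (hv t).2
      refine ⟨fun i => c ⟨d + i, by omega⟩, ?_⟩
      funext t
      by_cases h : d ≤ (t : ℕ)
      · simp only [φ, LinearMap.coe_mk, AddHom.coe_mk, dif_pos h, hc]
        congr 1
        ext
        simp only
        omega
      · rw [(hv t).1 (not_le.1 h)]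
        simp [φ, h]
  rw [← hrange, LinearMap.finrank_range_of_inj hinj]
  simp

/-- The coordinates of `𝔽₄^{sm}` as the first `sm` coordinates of `𝔽₄^n`. -/
def blockEmb {s m n : ℕ} (hn : s * m ≤ n) (p : Fin s × Fin m) : Fin n :=
  Fin.castLE hn (finProdFinEquiv p)

theorem blockEmb_injective {s m n : ℕ} (hn : s * m ≤ n) : Function.Injective (blockEmb hn) :=
  (Fin.castLE_injective hn).comp finProdFinEquiv.injective

theorem blockEmb_val {s m n : ℕ} (hn : s * m ≤ n) (p : Fin s × Fin m) :
    (blockEmb hn p : ℕ) = p.2 + m * p.1 := rfl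

theorem blockEmb_lt_iff {s m n : ℕ} (hn : s * m ≤ n) (p : Fin s × Fin m) (j : Fin s) :
    (blockEmb hn p : ℕ) < ((j : ℕ) + 1) * m ↔ p.1 ≤ j := by
  rw [blockEmb_val, Fin.le_def]
  have h2 := p.2.isLt
  constructor
  · intro h
    by_contra! hlt
    have := Nat.mul_le_mul_left m (show (j : ℕ) + 1 ≤ p.1 from hlt)
    nlinarith
  · intro h
    have := Nat.mul_le_mul_left m h
    nlinarith

theorem exists_blockEmb_eq {s m n : ℕ} (hn : s * m ≤ n) {t : Fin n} (ht : (t : ℕ) < s * m) :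
    ∃ p, blockEmb hn p = t := by
  refine ⟨finProdFinEquiv.symm ⟨t, ht⟩, ?_⟩
  rw [blockEmb, Equiv.apply_symm_apply]
  rfl

/-- The inclusion of `𝔽₄^{sm}` into `𝔽₄^n` as the first `sm` coordinates. -/
def blockInclusion {s m n : ℕ} (hn : s * m ≤ n) :
    (Fin s × Fin m → F4) →ₗ[ZMod 2] (Fin n → F4) where
  toFun u := Function.extend (blockEmb hn) u 0
  map_add' u v := by
    funext t
    by_cases h : ∃ p, blockEmb hn p = t
    · obtain ⟨p, rfl⟩ := h
      simp [(blockEmb_injective hn).extend_apply]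
    · simp [Function.extend_apply' _ _ _ h]
  map_smul' c u := by
    funext t
    by_cases h : ∃ p, blockEmb hn p = t
    · obtain ⟨p, rfl⟩ := h
      simp [(blockEmb_injective hn).extend_apply]
    · simp [Function.extend_apply' _ _ _ h]

theorem blockInclusion_apply {s m n : ℕ} (hn : s * m ≤ n) (u : Fin s × Fin m → F4)
    (p : Fin s × Fin m) : blockInclusion hn u (blockEmb hn p) = u p :=
  (blockEmb_injective hn).extend_apply _ _ _

theorem blockInclusion_apply' {s m n : ℕ} (hn : s * m ≤ n) (u : Fin s × Fin m → F4) {t : Fin n}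
    (h : ¬ ∃ p, blockEmb hn p = t) : blockInclusion hn u t = 0 :=
  Function.extend_apply' _ _ _ h

theorem blockInclusion_inner {s m n : ℕ} (hn : s * m ≤ n) (u v : Fin s × Fin m → F4) :
    traceInner (blockInclusion hn u) (blockInclusion hn v) = traceInner u v := by
  refine (Fintype.sum_of_injective (blockEmb hn) (blockEmb_injective hn) _ _ ?_ ?_).symm
  · intro t ht
    rw [blockInclusion_apply' hn u ht]
    simp
  · intro p
    rw [blockInclusion_apply, blockInclusion_apply]

theorem traceInner_eq_zero_of_mem_binaryTail {n d : ℕ} {u v : Fin n → F4} (hv : v ∈ binaryTail n d)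
    (hu : ∀ t : Fin n, d ≤ (t : ℕ) → u t ^ 2 = u t) : traceInner u v = 0 := by
  refine Finset.sum_eq_zero fun t _ => ?_
  rcases lt_or_ge (t : ℕ) d with h | h
  · rw [(hv t).1 h]; ring
  · rw [(hv t).2, hu t h]
    exact F4.add_self _

/-- Orthogonality to the unit vectors of the tail forces the tail coordinates to satisfy `x² = x`,
that is, to be binary. The other coordinates are free, and they are those of the first blocks. -/
theorem traceDual_binaryTail {s m n : ℕ} (hn : s * m ≤ n) (j : Fin s) :
    traceDual (binaryTail n (((j : ℕ) + 1) * m)) =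
      binaryTail n (((j : ℕ) + 1) * m) ⊔ (firstBlocks j).map (blockInclusion hn) := by
  have hjs : ((j : ℕ) + 1) * m ≤ s * m := Nat.mul_le_mul_right m j.isLt
  apply le_antisymm
  · intro v hv
    have hv' : ∀ t : Fin n, ((j : ℕ) + 1) * m ≤ t → v t ^ 2 = v t := by
      intro t ht
      have h := hv (Pi.single t 1) (by
        intro t'
        rcases eq_or_ne t' t with rfl | hne
        · simp only [Pi.single_eq_same, one_pow, and_true]
          intro h; omega
        · simp [Pi.single_eq_of_ne hne])
      rw [traceInner_single] at h
      linear_combination h - v t * F4.two_eq_zero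
    let u : Fin s × Fin m → F4 := fun p => if p.1 ≤ j then v (blockEmb hn p) else 0
    have hu : u ∈ firstBlocks j := by
      intro p hp
      simp [u, not_le.2 hp]
    have hsub : v - blockInclusion hn u ∈ binaryTail n (((j : ℕ) + 1) * m) := by
      intro t
      rcases lt_or_ge (t : ℕ) (((j : ℕ) + 1) * m) with h | h
      · obtain ⟨p, rfl⟩ := exists_blockEmb_eq hn (t := t) (by omega)
        have hp := (blockEmb_lt_iff hn p j).1 h
        simp [blockInclusion_apply, u, hp]
      · have h0 : blockInclusion hn u t = 0 := by
          by_cases hex : ∃ p, blockEmb hn p = t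
          · obtain ⟨p, rfl⟩ := hex
            have hp : ¬ p.1 ≤ j := fun hp => by
              have := (blockEmb_lt_iff hn p j).2 hp
              omega
            simp [blockInclusion_apply, u, hp]
          · exact blockInclusion_apply' hn u hex
        rw [Pi.sub_apply, h0, sub_zero]
        exact ⟨fun h' => by omega, hv' t h⟩
    rw [← sub_add_cancel v (blockInclusion hn u)]
    exact Submodule.add_mem_sup hsub (Submodule.mem_map_of_mem hu)
  · rw [sup_le_iff]
    refine ⟨fun u hu v hv => traceInner_eq_zero_of_mem_binaryTail hv fun t _ => (hu t).2, ?_⟩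
    rintro _ ⟨u, hu, rfl⟩ v hv
    refine traceInner_eq_zero_of_mem_binaryTail hv fun t ht => ?_
    by_cases hex : ∃ p, blockEmb hn p = t
    · obtain ⟨p, rfl⟩ := hex
      have hp : ¬ p.1 ≤ j := fun hp => by
        have := (blockEmb_lt_iff hn p j).2 hp
        omega
      rw [blockInclusion_apply, hu p (not_le.1 hp)]
      simp
    · rw [blockInclusion_apply' hn u hex]
      simp

/-! ### Isometries of the trace form and the choice of inner codes -/

section Isometries

variable {ι : Type} [Fintype ι]

theorem traceInner_isometry {g : (ι → F4) ≃ₗ[ZMod 2] (ι → F4)}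
    (hg : g ∈ isometryGroup (traceForm ι)) (u v : ι → F4) :
    traceInner (g u) (g v) = traceInner u v :=
  traceForm_eq_iff.1 (hg u v)

theorem traceDual_map {g : (ι → F4) ≃ₗ[ZMod 2] (ι → F4)}
    (hg : g ∈ isometryGroup (traceForm ι)) (C : AdditiveCode ι) :
    traceDual (C.map (g : (ι → F4) →ₗ[ZMod 2] (ι → F4))) =
      (traceDual C).map (g : (ι → F4) →ₗ[ZMod 2] (ι → F4)) := by
  ext u
  constructor
  · intro hu
    refine ⟨g.symm u, fun v hv => ?_, by simp⟩
    rw [← traceInner_isometry hg, LinearEquiv.apply_symm_apply]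
    exact hu _ (Submodule.mem_map_of_mem hv)
  · rintro ⟨u, hu, rfl⟩ _ ⟨v, hv, rfl⟩
    exact (traceInner_isometry hg u v).trans (hu v hv)

end Isometries

open Finset in
/-- Nested self-orthogonal codes with a compatible inner-product-preserving map `ρ`, such that the
nonzero vectors of their duals avoid prescribed small sets. -/
theorem exists_nested_avoiding {s m n : ℕ} (hn : s * m ≤ n) (W : Fin s → Finset (Fin n → F4))
    (hW : ∑ j : Fin s, 2 ^ (n + ((j : ℕ) + 1) * m) * #(W j) < 4 ^ n - 1) :
    ∃ (C : Fin s → AdditiveCode (Fin n)) (ρ : (Fin s × Fin m → F4) →ₗ[ZMod 2] (Fin n → F4)),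
      (∀ j, IsSelfOrthogonal (C j)) ∧
      (∀ j, Module.finrank (ZMod 2) (C j) + ((j : ℕ) + 1) * m = n) ∧
      (∀ i j, i ≤ j → C j ≤ C i) ∧
      (∀ u v, traceInner (ρ u) (ρ v) = traceInner u v) ∧
      (∀ j, traceDual (C j) = C j ⊔ (firstBlocks j).map ρ) ∧
      ∀ j, ∀ v ∈ traceDual (C j), v ≠ 0 → v ∉ W j := by
  classical
  let C₀ : Fin s → AdditiveCode (Fin n) := fun j => binaryTail n (((j : ℕ) + 1) * m)
  have hjn : ∀ j : Fin s, ((j : ℕ) + 1) * m ≤ n := fun j =>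
    (Nat.mul_le_mul_right m j.isLt).trans hn
  have : Finite ((Fin n → F4) ≃ₗ[ZMod 2] (Fin n → F4)) :=
    Finite.of_injective (fun g => (g : (Fin n → F4) → (Fin n → F4))) DFunLike.coe_injective
  have : Fintype (isometryGroup (traceForm (Fin n))) := Fintype.ofFinite _
  obtain ⟨g, hg⟩ := exists_smul_notMem (G := isometryGroup (traceForm (Fin n)))
    (S := (univ : Finset (Fin n → F4)).erase 0) (by
      intro g a ha
      simp only [mem_erase, mem_univ, and_true] at ha ⊢
      exact (LinearEquiv.map_ne_zero_iff g.1).2 ha) (by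
      intro a ha b hb
      simp only [mem_erase, mem_univ, and_true] at ha hb
      obtain ⟨g, hg, h⟩ := exists_isometry traceForm_isAlt traceForm_nondegenerate.1 ha hb
      exact ⟨⟨g, hg⟩, h⟩)
    (fun j => ({v | v ∈ traceDual (C₀ j)} : Finset (Fin n → F4)).erase 0)
    (fun j => (W j).erase 0) (fun j => erase_subset_erase _ (subset_univ _))
    (fun j => erase_subset_erase _ (subset_univ _)) (by
      rw [card_erase_of_mem (mem_univ _), card_univ, Fintype.card_fun, card_F4, Fintype.card_fin]
      refine lt_of_le_of_lt (sum_le_sum fun j _ => ?_) hW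
      refine Nat.mul_le_mul ((card_erase_le).trans ?_) card_erase_le
      have h1 := Module.card_eq_pow_finrank (K := ZMod 2) (V := traceDual (C₀ j))
      rw [finrank_traceDual, finrank_binaryTail, Fintype.card_fin, ZMod.card,
        Fintype.card_subtype] at h1
      rw [h1]
      have := hjn j
      exact Nat.pow_le_pow_right (by norm_num) (by omega))
  -- The chain and the block inclusion are moved by the same isometry, so duality, nesting,
  -- dimensions and the block decomposition carry over from the standard chain.
  refine ⟨fun j => (C₀ j).map (g.1 : (Fin n → F4) →ₗ[ZMod 2] (Fin n → F4)),
    (g.1 : (Fin n → F4) →ₗ[ZMod 2] (Fin n → F4)) ∘ₗ blockInclusion hn, ?_, ?_, ?_, ?_, ?_, ?_⟩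
  · intro j
    rw [IsSelfOrthogonal, traceDual_map g.2, traceDual_binaryTail hn]
    exact Submodule.map_mono le_sup_left
  · intro j
    rw [LinearEquiv.finrank_map_eq, finrank_binaryTail]
    have := hjn j
    omega
  · intro i j hij
    refine Submodule.map_mono fun v hv t => ⟨fun h => (hv t).1 (h.trans_le ?_), (hv t).2⟩
    exact Nat.mul_le_mul_right m (Nat.add_le_add_right hij 1)
  · intro u v
    exact (traceInner_isometry g.2 _ _).trans (blockInclusion_inner hn u v)
  · intro j
    rw [traceDual_map g.2, traceDual_binaryTail hn, Submodule.map_sup, Submodule.map_comp]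
  · intro j v hv hv0 hvW
    rw [traceDual_map g.2] at hv
    obtain ⟨u, hu, rfl⟩ := hv
    have hu0 : u ≠ 0 := by rintro rfl; exact hv0 (map_zero _)
    refine hg j u ?_ (mem_erase.2 ⟨hv0, hvW⟩)
    simpa [hu0] using hu

/-! ## The volume of Hamming balls -/

theorem sum_pow_hammingNorm (n : ℕ) (t : ℝ) [DecidableEq F4] :
    ∑ v : Fin n → F4, t ^ hammingNorm v = (1 + 3 * t) ^ n := by
  have h1 : ∀ v : Fin n → F4, t ^ hammingNorm v = ∏ i, if v i = 0 then 1 else t := by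
    intro v
    rw [Finset.prod_ite]
    simp [hammingNorm]
  have h2 : ∑ x : F4, (if x = 0 then 1 else t) = 1 + 3 * t := by
    have : ∀ x : F4, (if x = 0 then 1 else t) = t + if x = 0 then 1 - t else 0 := by
      intro x; split_ifs <;> ring
    simp only [this, Finset.sum_add_distrib, Finset.sum_const, Finset.card_univ, card_F4,
      Finset.sum_ite_eq', Finset.mem_univ, if_true]
    simp
    ring
  rw [Finset.sum_congr rfl fun v _ => h1 v]
  have h3 := Finset.prod_univ_sum (fun _ : Fin n => (Finset.univ : Finset F4))
    (fun _ x => if x = 0 then 1 else t)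
  rw [Fintype.piFinset_univ] at h3
  rw [← h3, Finset.prod_const, h2]
  simp

open Finset in
-- Chernoff bound: for `0 < t ≤ 1` each vector of the ball contributes at least `t^(xn)` to the
-- weight enumerator `(1 + 3t)^n`. The choice `t = x/(3(1-x))` minimises `(1 + 3t)/t^x`, giving
-- exactly `4^(H₄ x)`; it satisfies `t ≤ 1` because `x ≤ 3/4`.
theorem card_hammingBall_le (n : ℕ) {x : ℝ} (hx : 0 < x) (hx' : x ≤ 3 / 4) [DecidableEq F4] :
    (#{v : Fin n → F4 | (hammingNorm v : ℝ) ≤ x * n} : ℝ) ≤ (4 : ℝ) ^ (n * H4 x) := by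
  set t := x / (3 * (1 - x)) with ht
  have h1x : 0 < 1 - x := by linarith
  have ht0 : 0 < t := by positivity
  have ht1 : t ≤ 1 := by rw [ht, div_le_one (by positivity)]; linarith
  have hsum := sum_pow_hammingNorm n t
  have h13 : 1 + 3 * t = (1 - x)⁻¹ := by
    rw [ht]; field_simp; ring
  have hle : (#{v : Fin n → F4 | (hammingNorm v : ℝ) ≤ x * n} : ℝ) * t ^ (x * n) ≤
      (1 + 3 * t) ^ n := by
    rw [← hsum, ← nsmul_eq_mul]
    refine (card_nsmul_le_sum _ (fun v : Fin n → F4 => t ^ hammingNorm v) _ fun v hv => ?_).trans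
      (sum_le_sum_of_subset_of_nonneg (subset_univ _) fun _ _ _ => by positivity)
    rw [← Real.rpow_natCast]
    exact Real.rpow_le_rpow_of_exponent_ge ht0 ht1 (mem_filter.1 hv).2
  rw [← le_div_iff₀ (by positivity)] at hle
  refine hle.trans_eq ?_
  rw [h13, inv_pow, ← Real.rpow_natCast, ← Real.rpow_neg h1x.le, Real.rpow_def_of_pos h1x,
    Real.rpow_def_of_pos ht0, Real.rpow_def_of_pos (by norm_num : (0 : ℝ) < 4), ← Real.exp_sub]
  congr 1
  rw [ht, Real.log_div hx.ne' (by positivity), Real.log_mul (by norm_num) h1x.ne']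
  linear_combination -(n : ℝ) * H4_mul_log hx

/-! ## Self-dual bases -/

section Orthonormal

variable {V : Type*} [AddCommGroup V] [Module (ZMod 2) V]

/-- A finite family that is orthonormal for a bilinear form over `𝔽₂`. -/
def IsOrthonormal (B : LinearMap.BilinForm (ZMod 2) V) {n : ℕ} (e : Fin n → V) : Prop :=
  ∀ i j, B (e i) (e j) = if i = j then 1 else 0

variable {B : LinearMap.BilinForm (ZMod 2) V} {n : ℕ}

theorem IsOrthonormal.cons (hB : ∀ x y, B x y = B y x) {e : Fin n → V} (he : IsOrthonormal B e)
    {x : V} (hx : B x x = 1) (hxe : ∀ i, B x (e i) = 0) :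
    IsOrthonormal B (Fin.cons x e : Fin (n + 1) → V) := by
  intro i j
  refine Fin.cases ?_ (fun i => ?_) i <;> refine Fin.cases ?_ (fun j => ?_) j
  · simpa using hx
  · simpa [(Fin.succ_ne_zero j).symm] using hxe j
  · simpa [Fin.succ_ne_zero i, hB (e i) x] using hxe i
  · simpa using he i j

theorem IsOrthonormal.linearIndependent {e : Fin n → V} (he : IsOrthonormal B e) :
    LinearIndependent (ZMod 2) e := by
  refine LinearMap.BilinForm.linearIndependent_of_iIsOrtho (B := B) ?_ fun i => ?_
  · rw [LinearMap.BilinForm.iIsOrtho_def]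
    intro i j hij
    rw [he i j, if_neg hij]
  · rw [he i i, if_pos rfl]
    exact one_ne_zero

/-- In the orthogonal complement of the family there are `a`, `b` with `B(a,b) = 1`. If one of them
has square `1`, it is appended. Otherwise they span a hyperbolic plane, and together with one member
`e₀` of the family this plane has an orthonormal basis. -/
theorem IsOrthonormal.exists_longer [FiniteDimensional (ZMod 2) V] (hB : ∀ x y, B x y = B y x)
    (hn : B.Nondegenerate) {e : Fin (n + 1) → V} (he : IsOrthonormal B e)
    (hlt : n + 1 < Module.finrank (ZMod 2) V) :
    ∃ k, n + 1 < k ∧ ∃ e' : Fin k → V, IsOrthonormal B e' := by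
  obtain ⟨a, ha0, ha⟩ : ∃ a : V, a ≠ 0 ∧ ∀ i, B a (e i) = 0 := by
    have h1 := LinearMap.BilinForm.finrank_orthogonal hn (Submodule.span (ZMod 2) (Set.range e))
    have h2 := finrank_range_le_card (R := ZMod 2) e
    rw [Fintype.card_fin, Set.finrank] at h2
    have h3 : B.orthogonal (Submodule.span (ZMod 2) (Set.range e)) ≠ ⊥ := by
      intro h
      rw [h, finrank_bot] at h1
      omega
    obtain ⟨a, ha, ha0⟩ := Submodule.exists_mem_ne_zero_of_ne_bot h3
    refine ⟨a, ha0, fun i => ?_⟩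
    rw [hB]
    exact LinearMap.BilinForm.mem_orthogonal_iff.1 ha _ (Submodule.subset_span ⟨i, rfl⟩)
  obtain ⟨v, hv⟩ : ∃ v, B a v = 1 := by
    by_contra! h
    exact ha0 (hn.1 a fun v => (zmod_two_cases (B a v)).resolve_right (h v))
  let b := v - ∑ i, B v (e i) • e i
  have hb : ∀ i, B b (e i) = 0 := by
    intro i
    simp only [b, map_sub, map_sum, map_smul, LinearMap.sub_apply, LinearMap.sum_apply,
      LinearMap.smul_apply, he _ i, smul_eq_mul, mul_ite, mul_one, mul_zero, Finset.sum_ite_eq',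
      Finset.mem_univ, if_true, sub_self]
  have hab : B a b = 1 := by
    simp [b, ha, hv]
  rcases zmod_two_cases (B a a) with haa | haa
  · rcases zmod_two_cases (B b b) with hbb | hbb
    · have hba : B b a = 1 := by rw [hB, hab]
      have hea : ∀ i, B (e i) a = 0 := fun i => by rw [hB, ha]
      have heb : ∀ i, B (e i) b = 0 := fun i => by rw [hB, hb]
      have h00 : B (e 0) (e 0) = 1 := by rw [he, if_pos rfl]
      have h0s : ∀ i : Fin n, B (e 0) (e i.succ) = 0 := fun i => by
        rw [he, if_neg (Fin.succ_ne_zero i).symm]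
      have htail : IsOrthonormal B fun i : Fin n => e i.succ := by
        intro i j
        rw [he]
        simp
      have two : (1 + 1 : ZMod 2) = 0 := by decide
      -- `e₀` is replaced by the three vectors `e₀ + a`, `e₀ + b`, `e₀ + a + b`, which are
      -- orthonormal and orthogonal to the remaining members.
      have h1 := htail.cons hB (x := e 0 + a) (by simp [h00, haa, hea, ha]) (by simp [h0s, ha])
      have h2 := h1.cons hB (x := e 0 + b) (by simp [h00, hbb, heb, hb]) (by
        intro i
        refine Fin.cases ?_ (fun i => ?_) i
        · simp [h00, hea, hba, hb, two]
        · simp [h0s, hb])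
      refine ⟨_, by omega, _, h2.cons hB (x := e 0 + a + b) (by
        simp [h00, haa, hbb, heb, hb, hea, ha, hab, hba, add_assoc, two]) ?_⟩
      intro i
      refine Fin.cases ?_ (fun i => Fin.cases ?_ (fun i => ?_) i) i
      · simp [h00, heb, hab, hbb, ha, hb, two]
      · simp [h00, hea, haa, hba, ha, hb, two]
      · simp [h0s, ha, hb]
    · exact ⟨_, by omega, _, he.cons hB hbb hb⟩
  · exact ⟨_, by omega, _, he.cons hB haa ha⟩

/-- An orthonormal family of maximal length is a basis. The vector `x` is the initial nonempty
family; an alternating form on a nonzero space has no orthonormal vector at all. -/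
theorem exists_orthonormal_basis [FiniteDimensional (ZMod 2) V] (hB : ∀ x y, B x y = B y x)
    (hn : B.Nondegenerate) {x : V} (hx : B x x = 1) :
    ∃ b : Module.Basis (Fin (Module.finrank (ZMod 2) V)) (ZMod 2) V, IsOrthonormal B b := by
  classical
  set d := Module.finrank (ZMod 2) V
  let P : ℕ → Prop := fun k => ∃ e : Fin k → V, IsOrthonormal B e
  have hle : ∀ k, P k → k ≤ d := by
    rintro k ⟨e, he⟩
    simpa using he.linearIndependent.fintype_card_le_finrank
  have h1 : P 1 := by
    refine ⟨fun _ => x, fun i j => ?_⟩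
    rw [Subsingleton.elim i j, if_pos rfl, hx]
  have hN := Nat.findGreatest_spec (hle 1 h1) h1
  have hN1 : 1 ≤ Nat.findGreatest P d := Nat.le_findGreatest (hle 1 h1) h1
  have hNd : Nat.findGreatest P d = d := by
    refine le_antisymm (hle _ hN) (not_lt.1 fun hlt => ?_)
    obtain ⟨n, hn'⟩ := Nat.exists_eq_add_of_le' hN1
    obtain ⟨e, he⟩ := hN
    rw [hn'] at hlt
    obtain ⟨k, hk, hPk⟩ : ∃ k, n + 1 < k ∧ P k := by
      revert e
      rw [hn']
      intro e he
      exact he.exists_longer hB hn hlt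
    have := Nat.le_findGreatest (hle k hPk) hPk
    omega
  rw [hNd] at hN
  obtain ⟨e, he⟩ := hN
  rcases Nat.eq_zero_or_pos d with h0 | h0
  · have := hle 1 h1
    omega
  · have : Nonempty (Fin d) := ⟨⟨0, h0⟩⟩
    exact ⟨basisOfLinearIndependentOfCardEqFinrank he.linearIndependent (by simp [d]), by simpa⟩

end Orthonormal

theorem exists_selfDual_basis {m : ℕ} (hm : m ≠ 0) :
    ∃ b : Module.Basis (Fin m) (ZMod 2) (GaloisField 2 m),
      ∀ i j, Algebra.trace (ZMod 2) (GaloisField 2 m) (b i * b j) = if i = j then 1 else 0 := by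
  have hnd := _root_.traceForm_nondegenerate (ZMod 2) (GaloisField 2 m)
  obtain ⟨x, hx⟩ := Algebra.trace_surjective (ZMod 2) (GaloisField 2 m) 1
  -- Since the trace commutes with Frobenius, `tr(x²) = tr(x)² = tr(x) = 1`.
  have hxx : Algebra.traceForm (ZMod 2) (GaloisField 2 m) x x = 1 := by
    apply (algebraMap (ZMod 2) (GaloisField 2 m)).injective
    rw [Algebra.traceForm_apply, ← pow_two, FiniteField.algebraMap_trace_eq_sum_pow, ← hx,
      ← frobenius_def, ← ZMod.pow_card (Algebra.trace (ZMod 2) _ x), map_pow,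
      FiniteField.algebraMap_trace_eq_sum_pow, ← frobenius_def, map_sum]
    simp only [map_pow]
  obtain ⟨b, hb⟩ := exists_orthonormal_basis
    (fun x y => by simp only [Algebra.traceForm_apply, mul_comm]) hnd hxx
  refine ⟨b.reindex (finCongr (GaloisField.finrank 2 hm)), fun i j => ?_⟩
  have := hb ((finCongr (GaloisField.finrank 2 hm)).symm i)
    ((finCongr (GaloisField.finrank 2 hm)).symm j)
  rw [Algebra.traceForm_apply] at this
  simpa using this

/-! ## Reed–Solomon codes -/

section ReedSolomon

variable {m k : ℕ} {α : GaloisField 2 m}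

/-- Every monomial that occurs has exponent strictly between `0` and the order of `α`, and the power
sum of such an exponent over all powers of `α` vanishes. -/
theorem sum_pow_mul_eval_eq_zero (hα : IsPrimitiveRoot α (2 ^ m - 1))
    {q : Polynomial (GaloisField 2 m)} {e : ℕ} (he : 0 < e) (hq : q.natDegree + e < 2 ^ m - 1) :
    ∑ l : Fin (2 ^ m - 1), (α ^ (l : ℕ)) ^ e * q.eval (α ^ (l : ℕ)) = 0 := by
  simp only [Polynomial.eval_eq_sum_range, Finset.mul_sum]
  rw [Finset.sum_comm]
  refine Finset.sum_eq_zero fun j hj => ?_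
  have hj : j ≤ q.natDegree := by simpa [Nat.lt_succ_iff] using hj
  have h1 : ∀ l : Fin (2 ^ m - 1), (α ^ (l : ℕ)) ^ e * (q.coeff j * (α ^ (l : ℕ)) ^ j) =
      q.coeff j * (α ^ (e + j)) ^ (l : ℕ) := by
    intro l
    rw [← pow_mul α (e + j), mul_comm (e + j), pow_mul, pow_add]
    ring
  simp only [h1]
  rw [← Finset.mul_sum, Fin.sum_univ_eq_sum_range (fun l => (α ^ (e + j)) ^ l)]
  have hne : α ^ (e + j) ≠ 1 := hα.pow_ne_one_of_pos_of_lt (by omega) (by omega)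
  have h2 := geom_sum_mul (α ^ (e + j)) (2 ^ m - 1)
  rw [← pow_mul, mul_comm (e + j), pow_mul, hα.pow_eq_one, one_pow, sub_self] at h2
  rw [(mul_eq_zero.1 h2).resolve_right (sub_ne_zero.2 hne), mul_zero]

theorem mem_rsCode_iff (hα : IsPrimitiveRoot α (2 ^ m - 1))
    {c : Fin (2 ^ m - 1) → GaloisField 2 m} :
    c ∈ rsCode m k α ↔ ∀ i < 2 ^ m - 1 - k, ∑ l, c l * (α ^ i) ^ (l : ℕ) = 0 := by
  have heval : ∀ i, (∑ l, Polynomial.C (c l) * Polynomial.X ^ (l : ℕ)).eval (α ^ i) =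
      ∑ l, c l * (α ^ i) ^ (l : ℕ) := by
    intro i
    simp [Polynomial.eval_finsetSum]
  constructor
  · intro h i hi
    have h' := (Finset.dvd_prod_of_mem (fun i => Polynomial.X - Polynomial.C (α ^ i))
      (Finset.mem_range.2 hi)).trans h
    rw [Polynomial.dvd_iff_isRoot, Polynomial.IsRoot, heval] at h'
    exact h'
  · intro h
    refine Finset.prod_dvd_of_coprime ?_ fun i hi => ?_
    · intro i hi j hj hij
      refine Polynomial.isCoprime_X_sub_C_of_isUnit_sub (IsUnit.mk0 _ (sub_ne_zero.2 fun h => ?_))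
      simp only [Finset.coe_range, Set.mem_Iio] at hi hj
      exact hij (hα.pow_inj (by omega) (by omega) h)
    · rw [Polynomial.dvd_iff_isRoot, Polynomial.IsRoot, heval]
      exact h i (Finset.mem_range.1 hi)

/-- The factor `α^l` is there because the zeros of the generator polynomial start at `α^0`: it keeps
the exponents in the syndromes between `1` and `n₁ - 1`. -/
theorem eval_mem_rsCode (hα : IsPrimitiveRoot α (2 ^ m - 1)) (hk : k ≤ 2 ^ m - 1)
    {p : Polynomial (GaloisField 2 m)} (hp : p.degree < k) :
    (fun l : Fin (2 ^ m - 1) => α ^ (l : ℕ) * p.eval (α ^ (l : ℕ))) ∈ rsCode m k α := by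
  rw [mem_rsCode_iff hα]
  intro i hi
  rcases eq_or_ne p 0 with rfl | hp0
  · simp
  have hdeg : p.natDegree < k := (Polynomial.natDegree_lt_iff_degree_lt hp0).2 hp
  rw [← sum_pow_mul_eval_eq_zero hα (q := p) (e := i + 1) (by omega) (by omega)]
  refine Finset.sum_congr rfl fun l _ => ?_
  rw [← pow_mul α i, mul_comm i, pow_mul]
  ring

theorem primitiveRoot_ne_zero (hα : IsPrimitiveRoot α (2 ^ m - 1)) (l : Fin (2 ^ m - 1)) :
    α ≠ 0 := by
  rintro rfl
  have h := hα.pow_eq_one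
  rw [zero_pow (by have := l.isLt; omega)] at h
  exact zero_ne_one h

open Finset in
-- The MDS property, by Lagrange interpolation at distinct powers of `α`: a codeword can be
-- prescribed freely on any `k` positions.
theorem exists_eval_eq (hα : IsPrimitiveRoot α (2 ^ m - 1)) {S : Finset (Fin (2 ^ m - 1))}
    (hS : #S ≤ k) (y : Fin (2 ^ m - 1) → GaloisField 2 m) :
    ∃ p : Polynomial (GaloisField 2 m), p.degree < k ∧
      ∀ l ∈ S, α ^ (l : ℕ) * p.eval (α ^ (l : ℕ)) = y l := by
  classical
  have hinj : Set.InjOn (fun l : Fin (2 ^ m - 1) => α ^ (l : ℕ)) S := fun i _ j _ h =>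
    Fin.ext (hα.pow_inj i.isLt j.isLt h)
  refine ⟨Lagrange.interpolate S (fun l => α ^ (l : ℕ)) fun l => (α ^ (l : ℕ))⁻¹ * y l,
    (Lagrange.degree_interpolate_lt _ hinj).trans_le (by exact_mod_cast hS), fun l hl => ?_⟩
  rw [Lagrange.eval_interpolate_at_node _ hinj hl,
    mul_inv_cancel_left₀ (pow_ne_zero _ (primitiveRoot_ne_zero hα l))]

/-- Such a codeword is a polynomial of degree below that of the generator which divides it. Hence
the last `k` positions determine a codeword. -/
theorem eq_zero_of_mem_rsCode {c : Fin (2 ^ m - 1) → GaloisField 2 m} (hc : c ∈ rsCode m k α)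
    (h : ∀ l : Fin (2 ^ m - 1), 2 ^ m - 1 - k ≤ l → c l = 0) : c = 0 := by
  set p : Polynomial (GaloisField 2 m) := ∑ l, Polynomial.C (c l) * Polynomial.X ^ (l : ℕ) with hp
  have hcoeff : ∀ l : Fin (2 ^ m - 1), p.coeff l = c l := by
    intro l
    simp only [hp, Polynomial.finsetSum_coeff, Polynomial.coeff_C_mul_X_pow]
    rw [Finset.sum_eq_single l]
    · simp
    · intro j _ hj
      rw [if_neg fun h => hj (Fin.ext h.symm)]
    · simp
  have hdeg : p.degree < ((2 ^ m - 1 - k : ℕ) : WithBot ℕ) := by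
    rw [Polynomial.degree_lt_iff_coeff_zero]
    intro j hj
    simp only [hp, Polynomial.finsetSum_coeff, Polynomial.coeff_C_mul_X_pow]
    refine Finset.sum_eq_zero fun l _ => ?_
    split_ifs with hjl
    · exact h l (by omega)
    · rfl
  have hp0 : p = 0 := by
    refine Polynomial.eq_zero_of_dvd_of_degree_lt hc ?_
    rw [Polynomial.degree_prod, Finset.sum_congr rfl fun i _ => Polynomial.degree_X_sub_C _]
    simpa using hdeg
  funext l
  rw [← hcoeff, hp0]
  simp

open Finset in
theorem card_filter_le_val (n k : ℕ) (hk : k ≤ n) :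
    #{l : Fin n | n - k ≤ (l : ℕ)} = k := by
  have h : #(Ico (n - k) n) = k := by rw [Nat.card_Ico]; omega
  rw [← h]
  refine card_bij (fun l _ => (l : ℕ)) (fun l hl => ?_) (fun _ _ _ _ h => Fin.ext h) fun j hj => ?_
  · simpa [h] using hl
  · rw [mem_Ico] at hj
    exact ⟨⟨j, hj.2⟩, by simpa [h] using hj.1, rfl⟩

theorem mem_rsCode_iff_exists_eval (hα : IsPrimitiveRoot α (2 ^ m - 1)) (hk : k ≤ 2 ^ m - 1)
    {c : Fin (2 ^ m - 1) → GaloisField 2 m} :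
    c ∈ rsCode m k α ↔ ∃ p : Polynomial (GaloisField 2 m), p.degree < k ∧
      c = fun l : Fin (2 ^ m - 1) => α ^ (l : ℕ) * p.eval (α ^ (l : ℕ)) := by
  constructor
  · intro hc
    obtain ⟨p, hp, h⟩ := exists_eval_eq (k := k) hα (card_filter_le_val (2 ^ m - 1) k hk).le c
    refine ⟨p, hp, ?_⟩
    rw [← sub_eq_zero]
    refine eq_zero_of_mem_rsCode (Submodule.sub_mem _ hc (eval_mem_rsCode hα hk hp)) ?_
    intro l hl
    rw [Pi.sub_apply, h l (by simpa using hl), sub_self]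
  · rintro ⟨p, hp, rfl⟩
    exact eval_mem_rsCode hα hk hp

theorem finrank_rsCode (hα : IsPrimitiveRoot α (2 ^ m - 1)) (hk : k ≤ 2 ^ m - 1) :
    Module.finrank (GaloisField 2 m) (rsCode m k α) = k := by
  let S : Finset (Fin (2 ^ m - 1)) := {l | 2 ^ m - 1 - k ≤ (l : ℕ)}
  let φ : rsCode m k α →ₗ[GaloisField 2 m] (S → GaloisField 2 m) :=
    { toFun := fun c l => c.1 l
      map_add' := fun _ _ => rfl
      map_smul' := fun _ _ => rfl }
  have hinj : Function.Injective φ := by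
    rw [injective_iff_map_eq_zero]
    intro c hc
    refine Subtype.ext (eq_zero_of_mem_rsCode c.2 fun l hl => ?_)
    exact congrFun hc ⟨l, by simpa [S] using hl⟩
  have hsurj : Function.Surjective φ := by
    intro y
    obtain ⟨p, hp, h⟩ := exists_eval_eq (k := k) hα (card_filter_le_val (2 ^ m - 1) k hk).le
      (fun l => if hl : l ∈ S then y ⟨l, hl⟩ else 0)
    refine ⟨⟨_, eval_mem_rsCode hα hk hp⟩, ?_⟩
    funext l
    refine (h l l.2).trans ?_
    simp
  rw [(LinearEquiv.ofBijective φ ⟨hinj, hsurj⟩).finrank_eq, Module.finrank_fintype_fun_eq_card,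
    Fintype.card_coe]
  exact card_filter_le_val (2 ^ m - 1) k hk

/-- The products of coordinates are `α^(2l) (pq)(α^l)`, and `deg(pq) + 2 ≤ 2k < n₁`, so their sum
vanishes. -/
theorem rsCode_selfOrthogonal (hα : IsPrimitiveRoot α (2 ^ m - 1)) (hk : 2 * k < 2 ^ m - 1)
    {c c' : Fin (2 ^ m - 1) → GaloisField 2 m} (hc : c ∈ rsCode m k α)
    (hc' : c' ∈ rsCode m k α) : ∑ l, c l * c' l = 0 := by
  obtain ⟨p, hp, rfl⟩ := (mem_rsCode_iff_exists_eval hα (by omega)).1 hc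
  obtain ⟨q, hq, rfl⟩ := (mem_rsCode_iff_exists_eval hα (by omega)).1 hc'
  rcases eq_or_ne p 0 with rfl | hp0
  · simp
  rcases eq_or_ne q 0 with rfl | hq0
  · simp
  have hp' : p.natDegree < k := (Polynomial.natDegree_lt_iff_degree_lt hp0).2 hp
  have hq' : q.natDegree < k := (Polynomial.natDegree_lt_iff_degree_lt hq0).2 hq
  have hdeg := Polynomial.natDegree_mul_le (p := p) (q := q)
  rw [← sum_pow_mul_eval_eq_zero hα (q := p * q) (e := 2) (by omega) (by omega)]
  refine Finset.sum_congr rfl fun l _ => ?_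
  rw [Polynomial.eval_mul]
  ring

open Finset in
-- If the support had at most `k` positions, some codeword would be `1` at one of them and `0` at
-- the others, and its product with `X` would not vanish.
theorem lt_card_support_of_orthogonal_rsCode [DecidableEq (GaloisField 2 m)]
    (hα : IsPrimitiveRoot α (2 ^ m - 1))
    (hk : k ≤ 2 ^ m - 1) {X : Fin (2 ^ m - 1) → GaloisField 2 m}
    (hX : ∀ c ∈ rsCode m k α, ∑ l, X l * c l = 0) (hX0 : X ≠ 0) : k < #{l | X l ≠ 0} := by
  by_contra! hle
  obtain ⟨l₀, hl₀⟩ := Function.ne_iff.1 hX0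
  obtain ⟨p, hp, h⟩ := exists_eval_eq hα hle (Pi.single l₀ 1)
  have h1 := hX _ (eval_mem_rsCode hα hk hp)
  rw [Finset.sum_eq_single l₀] at h1
  · rw [h l₀ (by simpa using hl₀), Pi.single_eq_same, mul_one] at h1
    exact hl₀ h1
  · intro l _ hl
    by_cases hXl : X l = 0
    · rw [hXl, zero_mul]
    · rw [h l (by simpa using hXl), Pi.single_eq_of_ne hl, mul_zero]
  · simp

theorem exists_primitiveRoot (hm : m ≠ 0) :
    ∃ α : GaloisField 2 m, IsPrimitiveRoot α (2 ^ m - 1) := by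
  have := Fintype.ofFinite (GaloisField 2 m)
  obtain ⟨g, hg⟩ := IsCyclic.exists_generator (α := (GaloisField 2 m)ˣ)
  have h1 := orderOf_eq_card_of_forall_mem_zpowers hg
  rw [Nat.card_units, GaloisField.card 2 m hm] at h1
  refine ⟨(g : GaloisField 2 m), ?_⟩
  rw [← h1, ← orderOf_units]
  exact IsPrimitiveRoot.orderOf _

/-! ### Binary expansions -/

section BinaryExpansion

variable {n : ℕ} (b : Module.Basis (Fin m) (ZMod 2) (GaloisField 2 m))

/-- The vectors over `𝔽_{2^m}` with given binary coordinates. -/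
def fromBinary (n : ℕ) :
    (Fin n × Fin m → ZMod 2) ≃ₗ[ZMod 2] (Fin n → GaloisField 2 m) :=
  (LinearEquiv.curry (ZMod 2) (ZMod 2) (Fin n) (Fin m)).trans
    (LinearEquiv.piCongrRight fun _ => b.equivFun.symm)

theorem fromBinary_apply (x : Fin n × Fin m → ZMod 2) (l : Fin n) :
    fromBinary b n x l = ∑ j, x (l, j) • b j := by
  simp [fromBinary, Module.Basis.equivFun_symm_apply]

theorem mem_binaryExpansion {D : Submodule (GaloisField 2 m) (Fin n → GaloisField 2 m)}
    {x : Fin n × Fin m → ZMod 2} : x ∈ binaryExpansion b D ↔ fromBinary b n x ∈ D := by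
  have : fromBinary b n x = fun i => ∑ j, x (i, j) • b j := funext (fromBinary_apply b x)
  rw [this]
  exact Iff.rfl

theorem finrank_binaryExpansion (hm : m ≠ 0)
    (D : Submodule (GaloisField 2 m) (Fin n → GaloisField 2 m)) :
    Module.finrank (ZMod 2) (binaryExpansion b D) = m * Module.finrank (GaloisField 2 m) D := by
  have h1 : (binaryExpansion b D) = (D.restrictScalars (ZMod 2)).map
      ((fromBinary b n).symm : (Fin n → GaloisField 2 m) →ₗ[ZMod 2] _) := by
    ext x
    rw [mem_binaryExpansion, Submodule.mem_map_equiv]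
    simp
  rw [h1, LinearEquiv.finrank_map_eq]
  have h2 := Module.finrank_mul_finrank (ZMod 2) (GaloisField 2 m) D
  rw [GaloisField.finrank 2 hm] at h2
  exact h2.symm

variable {b}

theorem sum_mul_eq_trace
    (hb : ∀ i j, Algebra.trace (ZMod 2) (GaloisField 2 m) (b i * b j) = if i = j then 1 else 0)
    (x y : Fin n × Fin m → ZMod 2) :
    ∑ p, x p * y p = Algebra.trace (ZMod 2) (GaloisField 2 m)
      (∑ l, fromBinary b n x l * fromBinary b n y l) := by
  rw [map_sum, Fintype.sum_prod_type]
  refine Finset.sum_congr rfl fun l _ => ?_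
  rw [fromBinary_apply, fromBinary_apply, Finset.sum_mul_sum, map_sum]
  refine Finset.sum_congr rfl fun i _ => ?_
  simp [hb, mul_comm]

/-- As `D` is linear over `𝔽_{2^m}`, binary orthogonality in a self-dual basis gives `tr(γ ∑ X_l
c_l) = 0` for all `γ`; the trace form is nondegenerate. -/
theorem orthogonal_of_orthogonal_binaryExpansion
    (hb : ∀ i j, Algebra.trace (ZMod 2) (GaloisField 2 m) (b i * b j) = if i = j then 1 else 0)
    {D : Submodule (GaloisField 2 m) (Fin n → GaloisField 2 m)} {x : Fin n × Fin m → ZMod 2}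
    (hx : ∀ y ∈ binaryExpansion b D, ∑ p, x p * y p = 0) {c : Fin n → GaloisField 2 m}
    (hc : c ∈ D) : ∑ l, fromBinary b n x l * c l = 0 := by
  refine (_root_.traceForm_nondegenerate (ZMod 2) (GaloisField 2 m)).1 _ fun γ => ?_
  have h := hx ((fromBinary b n).symm (γ • c)) (by
    rw [mem_binaryExpansion, LinearEquiv.apply_symm_apply]
    exact D.smul_mem γ hc)
  rw [sum_mul_eq_trace hb, LinearEquiv.apply_symm_apply] at h
  rw [Algebra.traceForm_apply, ← h, Finset.sum_mul]
  congr 1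
  refine Finset.sum_congr rfl fun l _ => ?_
  rw [Pi.smul_apply, smul_eq_mul]
  ring

end BinaryExpansion

end ReedSolomon

/-! ### The additive code `ω D + ω̄ D` -/

section OmegaSum

variable {ι : Type} {ω : F4}

/-- The vector `ω x + ω̄ y`. -/
def omegaVec (ω : F4) :
    ((ι → ZMod 2) × (ι → ZMod 2)) →ₗ[ZMod 2] (ι → F4) where
  toFun z p := ω * algebraMap (ZMod 2) F4 (z.1 p) + ω ^ 2 * algebraMap (ZMod 2) F4 (z.2 p)
  map_add' z z' := by
    funext p
    simp only [Prod.fst_add, Prod.snd_add, Pi.add_apply, map_add]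
    ring
  map_smul' c z := by
    funext p
    simp only [Prod.smul_fst, Prod.smul_snd, Pi.smul_apply, smul_eq_mul, map_mul,
      RingHom.id_apply]
    rw [Algebra.smul_def]
    ring

theorem omegaVec_apply (x y : ι → ZMod 2) (p : ι) : omegaVec ω (x, y) p =
    ω * algebraMap (ZMod 2) F4 (x p) + ω ^ 2 * algebraMap (ZMod 2) F4 (y p) := rfl

theorem mem_omegaSum {D : Submodule (ZMod 2) (ι → ZMod 2)} {v : ι → F4} :
    v ∈ omegaSum ω D ↔ ∃ x ∈ D, ∃ y ∈ D, v = omegaVec ω (x, y) := by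
  refine exists_congr fun x => and_congr_right fun _ => exists_congr fun y =>
    and_congr_right fun _ => ?_
  rw [funext_iff]
  rfl

theorem algebraMap_sq (c : ZMod 2) :
    (algebraMap (ZMod 2) F4 c) ^ 2 = algebraMap (ZMod 2) F4 c := by
  rw [← map_pow, ZMod.pow_card]

theorem omega_cube (hω : ω ^ 2 = ω + 1) : ω ^ 3 = 1 := by
  linear_combination (ω + 1) * hω + ω * F4.two_eq_zero

theorem omega_mul_add_eq_zero (hω : ω ^ 2 = ω + 1) {a b : ZMod 2}
    (h : ω * algebraMap (ZMod 2) F4 a + ω ^ 2 * algebraMap (ZMod 2) F4 b = 0) :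
    a = 0 ∧ b = 0 := by
  have h3 := omega_cube hω
  have hω0 : ω ≠ 0 := by
    rintro rfl
    simp at h3
  rcases zmod_two_cases a with rfl | rfl <;> rcases zmod_two_cases b with rfl | rfl <;>
    simp only [map_zero, map_one, mul_zero, mul_one, zero_add, add_zero] at h
  · exact ⟨rfl, rfl⟩
  · exact absurd h (pow_ne_zero 2 hω0)
  · exact absurd h hω0
  · exact absurd (by linear_combination h - hω - ω * F4.two_eq_zero : (1 : F4) = 0) one_ne_zero

theorem finrank_omegaSum [Fintype ι] (hω : ω ^ 2 = ω + 1)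
    (D : Submodule (ZMod 2) (ι → ZMod 2)) :
    Module.finrank (ZMod 2) (omegaSum ω D) = 2 * Module.finrank (ZMod 2) D := by
  have hinj : Function.Injective (omegaVec (ι := ι) ω) := by
    rw [injective_iff_map_eq_zero]
    rintro ⟨x, y⟩ h
    have := fun p => omega_mul_add_eq_zero hω (congrFun h p)
    exact Prod.ext (funext fun p => (this p).1) (funext fun p => (this p).2)
  let φ : (D × D) →ₗ[ZMod 2] (ι → F4) := omegaVec ω ∘ₗ D.subtype.prodMap D.subtype
  have hφ : Function.Injective φ :=
    hinj.comp (Function.Injective.prodMap Subtype.val_injective Subtype.val_injective)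
  have hrange : omegaSum ω D = LinearMap.range φ := by
    ext v
    rw [mem_omegaSum, LinearMap.mem_range]
    constructor
    · rintro ⟨x, hx, y, hy, rfl⟩
      exact ⟨(⟨x, hx⟩, ⟨y, hy⟩), rfl⟩
    · rintro ⟨⟨x, y⟩, rfl⟩
      exact ⟨x, x.2, y, y.2, rfl⟩
  rw [hrange, LinearMap.finrank_range_of_inj hφ, Module.finrank_prod, two_mul]

/-- In the coordinates `(x, y)` the trace inner product is the standard symplectic form, because
`tr(ω · ω̄²) = 0` and `tr(ω · ω²) = 1` up to the order of the two basis vectors. -/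
theorem traceInner_omegaVec [Fintype ι] (hω : ω ^ 2 = ω + 1) (x y x' y' : ι → ZMod 2) :
    traceInner (omegaVec ω (x, y)) (omegaVec ω (x', y')) =
      algebraMap (ZMod 2) F4 (∑ p, x p * y' p + ∑ p, y p * x' p) := by
  rw [← Finset.sum_add_distrib, map_sum]
  refine Finset.sum_congr rfl fun p _ => ?_
  simp only [omegaVec_apply, map_add, map_mul]
  have ha := algebraMap_sq (x p)
  have hb := algebraMap_sq (y p)
  have hc := algebraMap_sq (x' p)
  have hd := algebraMap_sq (y' p)
  have h3 := omega_cube hω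
  have h4 := F4.pow_four ω
  have h2 := F4.two_eq_zero
  set a := algebraMap (ZMod 2) F4 (x p)
  set b := algebraMap (ZMod 2) F4 (y p)
  set c := algebraMap (ZMod 2) F4 (x' p)
  set d := algebraMap (ZMod 2) F4 (y' p)
  have e1 : ∀ {a b : F4}, a ^ 2 = a → b ^ 2 = b → (ω * a + ω ^ 2 * b) ^ 2 = ω ^ 2 * a + ω * b := by
    intro a b ha hb
    linear_combination ω ^ 2 * ha + ω ^ 4 * hb + b * h4 + ω ^ 3 * a * b * h2
  rw [e1 ha hb, e1 hc hd]
  linear_combination (a * d + b * c) * (hω + h4) + 2 * (a * c + b * d) * h3 +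
    ((a * c + b * d) + (a * d + b * c) * ω) * h2

theorem exists_eq_omegaVec (hω : ω ^ 2 = ω + 1) (v : ι → F4) :
    ∃ x y, v = omegaVec ω (x, y) := by
  have key : ∀ z : F4, ∃ a b : ZMod 2,
      z = ω * algebraMap (ZMod 2) F4 a + ω ^ 2 * algebraMap (ZMod 2) F4 b := by
    intro z
    have h3 := omega_cube hω
    have hz := F4.pow_four z
    -- `ω, ω²` is a self-dual basis of `𝔽₄`, so the coordinates of `z` are the traces `tr(zω)` and
    -- `tr(zω²)`.
    obtain ⟨a, ha⟩ := F4.exists_algebraMap_eq (x := z * ω + z ^ 2 * ω ^ 2) (by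
      linear_combination ω ^ 4 * hz + z * F4.pow_four ω + z ^ 3 * ω ^ 3 * F4.two_eq_zero)
    obtain ⟨b, hb⟩ := F4.exists_algebraMap_eq (x := z * ω ^ 2 + z ^ 2 * ω) (by
      linear_combination ω ^ 2 * hz + z ^ 2 * F4.pow_four ω + z ^ 3 * ω ^ 3 * F4.two_eq_zero)
    refine ⟨a, b, ?_⟩
    rw [ha, hb]
    linear_combination -z * F4.pow_four ω - z * hω - (z * ω + z ^ 2 * ω ^ 3) * F4.two_eq_zero
  choose a b h using fun p => key (v p)
  exact ⟨a, b, funext h⟩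

theorem orthogonal_of_mem_traceDual_omegaSum [Fintype ι] (hω : ω ^ 2 = ω + 1)
    {D : Submodule (ZMod 2) (ι → ZMod 2)} {x y : ι → ZMod 2}
    (h : omegaVec ω (x, y) ∈ traceDual (omegaSum ω D)) {z : ι → ZMod 2} (hz : z ∈ D) :
    ∑ p, x p * z p = 0 ∧ ∑ p, y p * z p = 0 := by
  have h1 := h _ (mem_omegaSum.2 ⟨0, D.zero_mem, z, hz, rfl⟩)
  have h2 := h _ (mem_omegaSum.2 ⟨z, hz, 0, D.zero_mem, rfl⟩)
  rw [traceInner_omegaVec hω, map_eq_zero] at h1 h2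
  exact ⟨by simpa using h1, by simpa using h2⟩

end OmegaSum

/-! ## Properties of quantum Reed–Solomon codes -/

theorem two_mul_lt_of_le {m k : ℕ} (hk₁ : 1 ≤ k) (hk₂ : k ≤ 2 ^ (m - 1) - 1) :
    m ≠ 0 ∧ 2 * k < 2 ^ m - 1 := by
  rcases m with _ | m
  · simp at hk₂
    omega
  · refine ⟨by omega, ?_⟩
    rw [Nat.add_sub_cancel] at hk₂
    rw [pow_succ]
    omega

theorem exists_isQuantumRS {m k : ℕ} (hk₁ : 1 ≤ k) (hk₂ : k ≤ 2 ^ (m - 1) - 1) :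
    ∃ B, IsQuantumRS m k B := by
  obtain ⟨hm, -⟩ := two_mul_lt_of_le hk₁ hk₂
  obtain ⟨ω, hω⟩ := F4.exists_omega
  obtain ⟨α, hα⟩ := exists_primitiveRoot hm
  obtain ⟨b, hb⟩ := exists_selfDual_basis hm
  exact ⟨_, hk₁, hk₂, ω, α, b, hω, hα, hb, rfl⟩

section IsQuantumRS

variable {m k : ℕ} {B : AdditiveCode (Fin (2 ^ m - 1) × Fin m)}

theorem IsQuantumRS.ne_zero_and_lt (h : IsQuantumRS m k B) : m ≠ 0 ∧ 2 * k < 2 ^ m - 1 :=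
  two_mul_lt_of_le h.1 h.2.1

theorem IsQuantumRS.traceInner_eq_zero (h : IsQuantumRS m k B) {u v : Fin (2 ^ m - 1) × Fin m → F4}
    (hu : u ∈ B) (hv : v ∈ B) : traceInner u v = 0 := by
  obtain ⟨hm, hk⟩ := h.ne_zero_and_lt
  obtain ⟨-, -, ω, α, b, hω, hα, hb, rfl⟩ := h
  obtain ⟨x, hx, y, hy, rfl⟩ := mem_omegaSum.1 hu
  obtain ⟨x', hx', y', hy', rfl⟩ := mem_omegaSum.1 hv
  rw [mem_binaryExpansion] at hx hy hx' hy'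
  rw [traceInner_omegaVec hω, sum_mul_eq_trace hb, sum_mul_eq_trace hb,
    rsCode_selfOrthogonal hα hk hx hy', rsCode_selfOrthogonal hα hk hy hx']
  simp

theorem IsQuantumRS.finrank_eq (h : IsQuantumRS m k B) :
    Module.finrank (ZMod 2) B = 2 * (m * k) := by
  obtain ⟨hm, hk⟩ := h.ne_zero_and_lt
  obtain ⟨-, -, ω, α, b, hω, hα, hb, rfl⟩ := h
  rw [finrank_omegaSum hω, finrank_binaryExpansion b hm, finrank_rsCode hα (by omega)]

open Classical Finset in
-- Writing `v = ωx + ω̄y`, one of `x`, `y` is nonzero. Read over `𝔽_{2^m}`, it is orthogonal to the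
-- Reed–Solomon code, so it has more than `k` nonzero coordinates, each lying over a nonzero block
-- of `v`.
theorem IsQuantumRS.lt_card_of_mem_traceDual (h : IsQuantumRS m k B)
    {v : Fin (2 ^ m - 1) × Fin m → F4} (hv : v ∈ traceDual B) (hv0 : v ≠ 0) :
    k < #{l | ∃ p, v (l, p) ≠ 0} := by
  obtain ⟨hm, hk⟩ := h.ne_zero_and_lt
  obtain ⟨-, -, ω, α, b, hω, hα, hb, rfl⟩ := h
  obtain ⟨x, y, rfl⟩ := exists_eq_omegaVec hω v
  have key : ∀ z : Fin (2 ^ m - 1) × Fin m → ZMod 2, z ≠ 0 →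
      (∀ c ∈ binaryExpansion b (rsCode m k α), ∑ p, z p * c p = 0) →
      (∀ p, z p ≠ 0 → omegaVec ω (x, y) p ≠ 0) →
      k < #{l | ∃ p, omegaVec ω (x, y) (l, p) ≠ 0} := by
    intro z hz0 hz hsupp
    have h1 := lt_card_support_of_orthogonal_rsCode hα (by omega)
      (fun c hc => orthogonal_of_orthogonal_binaryExpansion hb hz hc)
      ((LinearEquiv.map_ne_zero_iff (fromBinary b (2 ^ m - 1))).2 hz0)
    refine h1.trans_le (card_le_card fun l hl => ?_)
    simp only [mem_filter, mem_univ, true_and] at hl ⊢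
    by_contra! hcon
    refine hl ?_
    rw [fromBinary_apply]
    refine sum_eq_zero fun j _ => ?_
    rw [not_not.1 fun hne => hsupp (l, j) hne (hcon j), zero_smul]
  by_cases hx : x = 0
  · refine key y ?_ (fun c hc => (orthogonal_of_mem_traceDual_omegaSum hω hv hc).2) ?_
    · rintro rfl
      rw [hx] at hv0
      exact hv0 (map_zero _)
    · exact fun p hp h0 => hp (omega_mul_add_eq_zero hω h0).2
  · exact key x hx (fun c hc => (orthogonal_of_mem_traceDual_omegaSum hω hv hc).1)
      fun p hp h0 => hp (omega_mul_add_eq_zero hω h0).1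

end IsQuantumRS

/-! ## Properties of generalized concatenated quantum codes -/

section TraceInner

variable {ι κ : Type} [Fintype ι] [Fintype κ]

theorem traceInner_add_left (u v w : ι → F4) :
    traceInner (u + v) w = traceInner u w + traceInner v w := by
  simp only [← algebraMap_traceForm, map_add, LinearMap.add_apply]

theorem traceInner_add_right (u v w : ι → F4) :
    traceInner u (v + w) = traceInner u v + traceInner u w := by
  simp only [← algebraMap_traceForm, map_add]

theorem traceInner_zero_right (u : ι → F4) : traceInner u 0 = 0 := by
  simp only [← algebraMap_traceForm, map_zero]

theorem traceInner_prod (u v : ι × κ → F4) :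
    traceInner u v = ∑ i, traceInner (fun t => u (i, t)) (fun t => v (i, t)) :=
  Fintype.sum_prod_type _

open Classical in
theorem hammingNorm_prod (v : ι × κ → F4) :
    hammingNorm v = ∑ i, hammingNorm (fun t => v (i, t)) := by
  simp only [hammingNorm, Finset.card_filter]
  exact Fintype.sum_prod_type _

end TraceInner

namespace Construction

variable {s : ℕ} (Q : Construction s)

/-- The index of the smallest inner code. -/
def last : Fin s := ⟨s - 1, by have := Q.two_le; omega⟩

theorem le_last (j : Fin s) : j ≤ Q.last := by
  rw [Fin.le_def]
  have := j.isLt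
  simp only [last]
  omega

theorem lastInner_le (j : Fin s) : Q.lastInner ≤ Q.C j := Q.inner_nested j Q.last (Q.le_last j)

theorem finrank_lastInner : Module.finrank (ZMod 2) Q.lastInner + s * Q.m = Q.n₂ := by
  have h := Q.inner_dim Q.last
  have h2 := Q.two_le
  have e : ((Q.last : Fin s) : ℕ) + 1 = s := by simp only [last]; omega
  rw [e] at h
  exact h

theorem firstBlocks_last : (firstBlocks Q.last : AdditiveCode (Fin s × Fin Q.m)) = ⊤ := by
  rw [eq_top_iff]
  intro u _ p hp
  exact absurd hp (not_lt.2 (Q.le_last p.1))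

theorem traceDual_lastInner : traceDual Q.lastInner = Q.lastInner ⊔ LinearMap.range Q.ρ := by
  have h := Q.ρ_blocks Q.last
  rw [Q.firstBlocks_last, Submodule.map_top] at h
  exact h

theorem ρ_mem_traceDual (u : Fin s × Fin Q.m → F4) : Q.ρ u ∈ traceDual Q.lastInner := by
  rw [traceDual_lastInner]
  exact Submodule.mem_sup_right ⟨u, rfl⟩

theorem lastInner_selfOrthogonal : Q.lastInner ≤ traceDual Q.lastInner :=
  Q.inner_selfOrthogonal Q.last

/-- Elements of `C_s` are orthogonal to the image of `ρ`, so by isometry `u` lies in the radical of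
the trace form. This makes the induced map to `C_s^⊥/C_s` injective. -/
theorem eq_zero_of_ρ_mem {u : Fin s × Fin Q.m → F4} (h : Q.ρ u ∈ Q.lastInner) : u = 0 :=
  eq_zero_of_traceInner_eq_zero fun v => by
    rw [← Q.ρ_inner, traceInner_comm]
    exact Q.ρ_mem_traceDual v _ h

theorem traceInner_ρ_add {x y : Fin s × Fin Q.m → F4} {u v : Fin Q.n₂ → F4}
    (hu : u ∈ Q.lastInner) (hv : v ∈ Q.lastInner) :
    traceInner (Q.ρ x + u) (Q.ρ y + v) = traceInner x y := by
  rw [traceInner_add_left, traceInner_add_right, traceInner_add_right, Q.ρ_inner,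
    Q.ρ_mem_traceDual x v hv, traceInner_comm u, Q.ρ_mem_traceDual y u hu,
    Q.lastInner_selfOrthogonal hu v hv]
  simp

/-- The `l`-th column of an `s × n₁` matrix over `𝔽₄^m`. -/
def column (b : Fin s → (Fin Q.n₁ × Fin Q.m → F4)) (l : Fin Q.n₁) : Fin s × Fin Q.m → F4 :=
  fun p => b p.1 (l, p.2)

theorem sum_traceInner_column (b b' : Fin s → (Fin Q.n₁ × Fin Q.m → F4)) :
    ∑ l, traceInner (Q.column b l) (Q.column b' l) = ∑ i, traceInner (b i) (b' i) := by
  simp only [traceInner_prod]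
  exact Finset.sum_comm

/-- The vector with blocks `ρ(column b l) + u l`. -/
def encode (b : Fin s → (Fin Q.n₁ × Fin Q.m → F4)) (u : Fin Q.n₁ → (Fin Q.n₂ → F4)) :
    Fin Q.n₁ × Fin Q.n₂ → F4 := fun q => Q.ρ (Q.column b q.1) q.2 + u q.1 q.2

theorem encode_block (b : Fin s → (Fin Q.n₁ × Fin Q.m → F4)) (u : Fin Q.n₁ → (Fin Q.n₂ → F4))
    (l : Fin Q.n₁) : (fun t => Q.encode b u (l, t)) = Q.ρ (Q.column b l) + u l := rfl

theorem mem_code {w : Fin Q.n₁ × Fin Q.n₂ → F4} : w ∈ Q.code ↔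
    ∃ b, (∀ i, b i ∈ Q.B i) ∧ ∃ u, (∀ l, u l ∈ Q.lastInner) ∧ w = Q.encode b u := by
  refine exists_congr fun b => and_congr_right fun _ => exists_congr fun u =>
    and_congr_right fun _ => ?_
  rw [funext_iff, Prod.forall]
  rfl

theorem traceInner_encode {b b' : Fin s → (Fin Q.n₁ × Fin Q.m → F4)}
    {u u' : Fin Q.n₁ → (Fin Q.n₂ → F4)} (hu : ∀ l, u l ∈ Q.lastInner)
    (hu' : ∀ l, u' l ∈ Q.lastInner) :
    traceInner (Q.encode b u) (Q.encode b' u') = ∑ i, traceInner (b i) (b' i) := by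
  rw [traceInner_prod, ← sum_traceInner_column]
  refine Finset.sum_congr rfl fun l _ => ?_
  rw [encode_block, encode_block, Q.traceInner_ρ_add (hu l) (hu' l)]

theorem code_selfOrthogonal : IsSelfOrthogonal Q.code := by
  intro w hw w' hw'
  obtain ⟨b, hb, u, hu, rfl⟩ := Q.mem_code.1 hw
  obtain ⟨b', hb', u', hu', rfl⟩ := Q.mem_code.1 hw'
  rw [Q.traceInner_encode hu hu']
  exact Finset.sum_eq_zero fun i _ => (Q.outer i).traceInner_eq_zero (hb i) (hb' i)

theorem column_zero (l : Fin Q.n₁) : Q.column 0 l = 0 := rfl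

/-- The dual is obtained by the same concatenation from the outer duals. Testing against `C_s` in a
single block puts each block in `C_s^⊥ = C_s + im ρ`; testing against codewords coming from a single
`B_i` puts `b_i` in `B_i^⊥`. -/
theorem exists_of_mem_traceDual_code {w : Fin Q.n₁ × Fin Q.n₂ → F4} (hw : w ∈ traceDual Q.code) :
    ∃ b, (∀ i, b i ∈ traceDual (Q.B i)) ∧ ∃ u, (∀ l, u l ∈ Q.lastInner) ∧ w = Q.encode b u := by
  classical
  have h1 : ∀ l, (fun t => w (l, t)) ∈ traceDual Q.lastInner := by
    intro l c hc
    have hmem : Q.encode 0 (Pi.single l c) ∈ Q.code := by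
      refine Q.mem_code.2 ⟨0, fun i => (Q.B i).zero_mem, _, fun l' => ?_, rfl⟩
      rcases eq_or_ne l' l with rfl | hne
      · rwa [Pi.single_eq_same]
      · rw [Pi.single_eq_of_ne hne]
        exact Q.lastInner.zero_mem
    have h := hw _ hmem
    rw [traceInner_prod, Finset.sum_eq_single l] at h
    · simpa [encode, column_zero] using h
    · intro l' _ hne
      have e : (fun t => Q.encode 0 (Pi.single l c) (l', t)) = 0 := by
        funext t
        simp [encode, column_zero, Pi.single_eq_of_ne hne]
      rw [e, traceInner_zero_right]
    · simp
  have h2 : ∀ l, ∃ x, ∃ u ∈ Q.lastInner, (fun t => w (l, t)) = Q.ρ x + u := by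
    intro l
    have h := h1 l
    rw [traceDual_lastInner] at h
    obtain ⟨u, hu, _, ⟨x, rfl⟩, h⟩ := Submodule.mem_sup.1 h
    exact ⟨x, u, hu, by rw [← h, add_comm]⟩
  choose x u hu hx using h2
  let b : Fin s → (Fin Q.n₁ × Fin Q.m → F4) := fun i q => x q.1 (i, q.2)
  have hwb : w = Q.encode b u := funext fun q => congrFun (hx q.1) q.2
  refine ⟨b, fun i b' hb' => ?_, u, hu, hwb⟩
  have h := hw _ (Q.mem_code.2 ⟨Pi.single i b', fun i' => ?_, 0, fun _ => Q.lastInner.zero_mem, rfl⟩)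
  · rw [hwb, Q.traceInner_encode (u' := 0) hu (fun _ => Q.lastInner.zero_mem), Finset.sum_eq_single i] at h
    · rwa [Pi.single_eq_same] at h
    · intro i' _ hne
      rw [Pi.single_eq_of_ne hne, traceInner_zero_right]
    · simp
  · rcases eq_or_ne i' i with rfl | hne
    · rwa [Pi.single_eq_same]
    · rw [Pi.single_eq_of_ne hne]
      exact (Q.B i').zero_mem

/-! ### Distance, dimension and rate of the concatenated code -/

theorem encode_block_ne_zero {b : Fin s → (Fin Q.n₁ × Fin Q.m → F4)}
    {u : Fin Q.n₁ → (Fin Q.n₂ → F4)} (hu : ∀ l, u l ∈ Q.lastInner) {l : Fin Q.n₁}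
    (hb : Q.column b l ≠ 0) : (fun t => Q.encode b u (l, t)) ≠ 0 := by
  intro h
  refine hb (Q.eq_zero_of_ρ_mem ?_)
  have h' : Q.ρ (Q.column b l) + u l = 0 := h
  rw [add_eq_zero_iff_eq_neg.1 h']
  exact Q.lastInner.neg_mem (hu l)

theorem encode_block_mem {b : Fin s → (Fin Q.n₁ × Fin Q.m → F4)}
    {u : Fin Q.n₁ → (Fin Q.n₂ → F4)} (hu : ∀ l, u l ∈ Q.lastInner) (l : Fin Q.n₁) {j : Fin s}
    (hb : ∀ i, j < i → b i = 0) : (fun t => Q.encode b u (l, t)) ∈ traceDual (Q.C j) := by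
  rw [encode_block, Q.ρ_blocks j, sup_comm]
  refine Submodule.add_mem_sup (Submodule.mem_map_of_mem fun p hp => ?_) (Q.lastInner_le j (hu l))
  rw [column, hb p.1 hp]
  rfl

open Classical Finset in
theorem le_hammingNorm_of_mem_traceDual {d : Fin s → ℝ} {D : ℝ} (hd₀ : ∀ j, 0 ≤ d j)
    (hd : ∀ j, ∀ v ∈ traceDual (Q.C j), v ≠ 0 → d j ≤ hammingNorm v)
    (hD : ∀ j, D ≤ ((Q.k j : ℝ) + 1) * d j) {w : Fin Q.n₁ × Fin Q.n₂ → F4}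
    (hw : w ∈ traceDual Q.code) (hw' : w ∉ Q.code) : D ≤ hammingNorm w := by
  obtain ⟨b, hb, u, hu, rfl⟩ := Q.exists_of_mem_traceDual_code hw
  have hne : ({i | b i ≠ 0} : Finset (Fin s)).Nonempty := by
    by_contra! h
    refine hw' (Q.mem_code.2 ⟨b, fun i => ?_, u, hu, rfl⟩)
    have : b i = 0 := by
      by_contra hi
      exact notMem_empty i (h ▸ mem_filter.2 ⟨mem_univ i, hi⟩)
    rw [this]
    exact (Q.B i).zero_mem
  -- The last nonzero outer component decides: beyond `j` all components vanish, so every block lies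
  -- in `C_j^⊥`, where the weight bound `d j` applies.
  obtain ⟨j, hj, hmax⟩ := exists_max_image _ id hne
  have hj0 : b j ≠ 0 := (mem_filter.1 hj).2
  have hj' : ∀ i, j < i → b i = 0 := by
    intro i hi
    by_contra h
    exact absurd (hmax i (mem_filter.2 ⟨mem_univ i, h⟩)) (not_le.2 hi)
  have hcard := (Q.outer j).lt_card_of_mem_traceDual (hb j) hj0
  set L : Finset (Fin Q.n₁) := {l | ∃ p, b j (l, p) ≠ 0}
  have h1 : ∀ l ∈ L, d j ≤ (hammingNorm (fun t => Q.encode b u (l, t)) : ℝ) := by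
    intro l hl
    obtain ⟨p, hp⟩ := (mem_filter.1 hl).2
    refine hd j _ (Q.encode_block_mem hu l hj') (Q.encode_block_ne_zero hu fun h => hp ?_)
    exact congrFun h (j, p)
  have h2 : (#L : ℝ) * d j ≤ hammingNorm (Q.encode b u) := by
    rw [hammingNorm_prod, Nat.cast_sum, ← nsmul_eq_mul]
    exact (card_nsmul_le_sum _ _ _ h1).trans
      (sum_le_sum_of_subset_of_nonneg (subset_univ _) fun _ _ _ => Nat.cast_nonneg _)
  refine (hD j).trans (le_trans (mul_le_mul_of_nonneg_right ?_ (hd₀ j)) h2)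
  exact_mod_cast hcard

theorem finrank_code : Module.finrank (ZMod 2) Q.code =
    Q.n₁ * Module.finrank (ZMod 2) Q.lastInner + ∑ i, 2 * (Q.m * Q.k i) := by
  let Φ : ((∀ i, Q.B i) × (Fin Q.n₁ → Q.lastInner)) →ₗ[ZMod 2] (Fin Q.n₁ × Fin Q.n₂ → F4) :=
    { toFun := fun z => Q.encode (fun i => z.1 i) (fun l => z.2 l)
      map_add' := by
        intro z z'
        funext q
        have : Q.column (fun i => ((z + z').1 i : Fin Q.n₁ × Fin Q.m → F4)) q.1 =
          Q.column (fun i => z.1 i) q.1 + Q.column (fun i => z'.1 i) q.1 := rfl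
        simp only [encode, this, map_add, Pi.add_apply, Prod.snd_add, Submodule.coe_add]
        ring
      map_smul' := by
        intro c z
        funext q
        have : Q.column (fun i => ((c • z).1 i : Fin Q.n₁ × Fin Q.m → F4)) q.1 =
          c • Q.column (fun i => z.1 i) q.1 := rfl
        simp only [encode, this, map_smul, Pi.smul_apply, Prod.smul_snd, Submodule.coe_smul,
          RingHom.id_apply, smul_add] }
  have hinj : Function.Injective Φ := by
    rw [injective_iff_map_eq_zero]
    rintro ⟨b, u⟩ h
    have hl : ∀ l, Q.column (fun i => b i) l = 0 := by
      intro l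
      by_contra hne
      exact Q.encode_block_ne_zero (u := fun l => u l) (fun l => (u l).2) hne
        (funext fun t => congrFun h (l, t))
    refine Prod.ext (funext fun i => Subtype.ext (funext fun q => ?_))
      (funext fun l => Subtype.ext (funext fun t => ?_))
    · exact congrFun (hl q.1) (i, q.2)
    · have h' : Q.ρ (Q.column (fun i => b i) l) t + (u l : Fin Q.n₂ → F4) t = 0 :=
        congrFun h (l, t)
      rw [hl, map_zero] at h'
      simpa using h'
  have hrange : Q.code = LinearMap.range Φ := by
    ext w
    rw [mem_code, LinearMap.mem_range]
    constructor
    · rintro ⟨b, hb, u, hu, rfl⟩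
      exact ⟨(fun i => ⟨b i, hb i⟩, fun l => ⟨u l, hu l⟩), rfl⟩
    · rintro ⟨⟨b, u⟩, rfl⟩
      exact ⟨_, fun i => (b i).2, _, fun l => (u l).2, rfl⟩
  rw [hrange, LinearMap.finrank_range_of_inj hinj, Module.finrank_prod, Module.finrank_pi_fintype,
    Module.finrank_pi_fintype, Finset.sum_congr rfl fun i _ => (Q.outer i).finrank_eq]
  simp [add_comm]

theorem m_ne_zero : Q.m ≠ 0 := ((Q.outer Q.last).ne_zero_and_lt).1

theorem finrank_code_add : Module.finrank (ZMod 2) Q.code + Q.n₁ * (s * Q.m) =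
    Q.n₁ * Q.n₂ + 2 * Q.m * ∑ i, Q.k i := by
  have h := congrArg (Q.n₁ * ·) Q.finrank_lastInner
  simp only [mul_add] at h
  rw [Q.finrank_code, Finset.mul_sum, ← h]
  simp only [mul_assoc]
  ring

theorem finrank_code_lt : Module.finrank (ZMod 2) Q.code < Q.n₁ * Q.n₂ := by
  have h := Q.finrank_code_add
  have hs := Q.two_le
  have h1 : ∑ i, 2 * Q.k i < ∑ _i : Fin s, Q.n₁ :=
    Finset.sum_lt_sum_of_nonempty ⟨Q.last, Finset.mem_univ _⟩
      fun i _ => ((Q.outer i).ne_zero_and_lt).2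
  rw [← Finset.mul_sum] at h1
  simp only [Finset.sum_const, Finset.card_univ, Fintype.card_fin, smul_eq_mul] at h1
  have h2 := Nat.mul_lt_mul_of_pos_left h1 (Nat.pos_of_ne_zero Q.m_ne_zero)
  have e1 : Q.m * (2 * ∑ i, Q.k i) = 2 * Q.m * ∑ i, Q.k i := by ring
  have e2 : Q.m * (s * Q.n₁) = Q.n₁ * (s * Q.m) := by ring
  rw [e1, e2] at h2
  omega

theorem card_coordinates : Fintype.card (Fin Q.n₁ × Fin Q.n₂) = Q.n₁ * Q.n₂ := by
  simp

theorem length_pos : 0 < Q.n₁ * Q.n₂ := Nat.zero_le _ |>.trans_lt Q.finrank_code_lt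

theorem quantumRate_code : quantumRate Q.code =
    (Q.m / Q.n₂ : ℝ) * (s - ∑ i, 2 * (Q.k i : ℝ) / Q.n₁) := by
  have hN := Q.length_pos
  have h1 : (0 : ℝ) < Q.n₁ := by exact_mod_cast Nat.pos_of_mul_pos_right hN
  have h2 : (0 : ℝ) < Q.n₂ := by exact_mod_cast Nat.pos_of_mul_pos_left hN
  have h : (Module.finrank (ZMod 2) Q.code : ℝ) + Q.n₁ * (s * Q.m) =
    Q.n₁ * Q.n₂ + 2 * Q.m * ∑ i, (Q.k i : ℝ) := by exact_mod_cast Q.finrank_code_add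
  rw [quantumRate, card_coordinates, Nat.cast_mul, ← Finset.sum_div, ← Finset.mul_sum]
  field_simp
  linarith

/-- The rate is positive because `2k_i < n₁`. Thus the infimum defining the minimum distance is
attained, and is not the default value `0` of an empty set. -/
theorem exists_mem_traceDual_notMem : ∃ v ∈ traceDual Q.code, v ∉ Q.code := by
  by_contra! h
  have h1 := Submodule.finrank_mono (show traceDual Q.code ≤ Q.code from h)
  rw [finrank_traceDual, card_coordinates] at h1
  have := Q.finrank_code_lt
  omega

open Classical in
theorem le_quantumRelDist {d : Fin s → ℝ} {δ : ℝ} (hd₀ : ∀ j, 0 ≤ d j)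
    (hd : ∀ j, ∀ v ∈ traceDual (Q.C j), v ≠ 0 → d j ≤ hammingNorm v)
    (hD : ∀ j, δ * (Q.n₁ * Q.n₂) ≤ ((Q.k j : ℝ) + 1) * d j) : δ ≤ quantumRelDist Q.code := by
  have hN : (0 : ℝ) < Q.n₁ * Q.n₂ := by exact_mod_cast Q.length_pos
  rw [quantumRelDist, card_coordinates, Nat.cast_mul, le_div_iff₀ hN]
  obtain ⟨v, hv, hv'⟩ := Q.exists_mem_traceDual_notMem
  obtain ⟨w, hw, hw', h⟩ := Nat.sInf_mem (s := {w | ∃ v ∈ traceDual Q.code, v ∉ Q.code ∧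
    hammingNorm v = w}) ⟨_, v, hv, hv', rfl⟩
  rw [quantumMinDist, ← h]
  exact Q.le_hammingNorm_of_mem_traceDual hd₀ hd hD hw hw'

end Construction

/-! ## Existence of good generalized concatenated quantum codes -/

theorem sum_Icc_one_eq_sum_fin (s : ℕ) (f : ℕ → ℝ) :
    ∑ j ∈ Finset.Icc 1 s, f j = ∑ i : Fin s, f (i + 1) := by
  induction s with
  | zero => simp
  | succ s ih => rw [Finset.sum_Icc_succ_top (by omega), ih, Fin.sum_univ_castSucc]; simp

/-- The counting condition for the inner codes after division by `4^n`; the term `4^(-n)` accounts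
for the zero vector. -/
theorem eventually_sum_rpow_lt {s : ℕ} {η : Fin s → ℝ} (hη : ∀ j, 0 < η j) :
    ∀ᶠ n : ℕ in atTop, ∑ j, (4 : ℝ) ^ (-(n * η j)) + (4 : ℝ) ^ (-(n : ℝ)) < 1 := by
  have h1 : ∀ a : ℝ, 0 < a → Tendsto (fun n : ℕ => (4 : ℝ) ^ (-(n * a))) atTop (𝓝 0) := by
    intro a ha
    have h2 : Tendsto (fun n : ℕ => (n : ℝ) * a) atTop atTop :=
      tendsto_natCast_atTop_atTop.atTop_mul_const ha
    exact (tendsto_rpow_atBot_of_base_gt_one 4 (by norm_num)).comp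
      (tendsto_neg_atTop_atBot.comp h2)
  have h3 : Tendsto (fun n : ℕ => ∑ j, (4 : ℝ) ^ (-(n * η j)) + (4 : ℝ) ^ (-(n : ℝ))) atTop
      (𝓝 (∑ _j : Fin s, 0 + 0)) := by
    refine (tendsto_finsetSum _ fun j _ => h1 _ (hη j)).add ?_
    simpa using h1 1 one_pos
  rw [Finset.sum_const_zero, add_zero] at h3
  exact h3.eventually_lt_const one_pos

open Finset in
/-- A sum of volumes of Hamming balls is small enough for the existence of nested inner codes. -/
theorem sum_card_hammingBall_lt {s m n : ℕ} {r : ℝ} (hs : 0 < s) (hmn : (s * m : ℝ) ≤ r * n)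
    {x : Fin s → ℝ} (hx₀ : ∀ j, 0 < x j) (hx₁ : ∀ j, x j ≤ 3 / 4) [DecidableEq F4]
    (h : ∑ j : Fin s, (4 : ℝ) ^ (-(n * (1 / 2 * (1 - r * ((j : ℕ) + 1 : ℕ) / s) - H4 (x j)))) +
      (4 : ℝ) ^ (-(n : ℝ)) < 1) :
    ∑ j : Fin s, 2 ^ (n + ((j : ℕ) + 1) * m) *
      #{v : Fin n → F4 | (hammingNorm v : ℝ) ≤ x j * n} < 4 ^ n - 1 := by
  have hs' : (0 : ℝ) < s := by exact_mod_cast hs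
  rw [Nat.lt_sub_iff_add_lt, ← Nat.cast_lt (α := ℝ)]
  push_cast
  have h4 : (0 : ℝ) < 4 ^ n := by positivity
  have h4n : (4 : ℝ) ^ n = (4 : ℝ) ^ (n : ℝ) := (Real.rpow_natCast _ _).symm
  have h' := mul_lt_mul_of_pos_left h h4
  rw [mul_add, mul_sum, mul_one] at h'
  refine lt_of_le_of_lt (add_le_add (sum_le_sum fun j _ => ?_) ?_) h'
  · have h2 : (2 : ℝ) ^ (n + ((j : ℕ) + 1) * m) ≤
        (4 : ℝ) ^ (n * (1 / 2) + n * (r * ((j : ℕ) + 1 : ℕ) / s) / 2) := by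
      have e : (2 : ℝ) ^ (n + ((j : ℕ) + 1) * m) =
          (4 : ℝ) ^ ((n : ℝ) * (1 / 2) + (((j : ℕ) + 1 : ℕ) * m : ℝ) / 2) := by
        rw [show (4 : ℝ) = 2 ^ (2 : ℝ) by norm_num, ← Real.rpow_mul (by norm_num),
          ← Real.rpow_natCast]
        congr 1
        push_cast
        ring
      rw [e]
      refine Real.rpow_le_rpow_of_exponent_le (by norm_num) ?_
      have hm : (m : ℝ) ≤ r * n / s := by
        rw [le_div_iff₀ hs']
        linarith
      have := mul_le_mul_of_nonneg_left hm (Nat.cast_nonneg (α := ℝ) ((j : ℕ) + 1))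
      have e2 : (n : ℝ) * (r * ((j : ℕ) + 1 : ℕ) / s) = (((j : ℕ) + 1 : ℕ) : ℝ) * (r * n / s) := by
        ring
      rw [e2]
      linarith
    refine (mul_le_mul h2 (card_hammingBall_le n (hx₀ j) (hx₁ j)) (Nat.cast_nonneg _)
      (by positivity)).trans_eq ?_
    rw [h4n, ← Real.rpow_add (by norm_num), ← Real.rpow_add (by norm_num)]
    congr 1
    ring
  · rw [h4n, ← Real.rpow_add (by norm_num)]
    simp

theorem tendsto_two_pow_sub_one :
    Tendsto (fun m : ℕ => ((2 ^ m - 1 : ℕ) : ℝ)) atTop atTop := by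
  refine tendsto_natCast_atTop_atTop.comp ?_
  exact (tendsto_sub_atTop_nat 1).comp (tendsto_pow_atTop_atTop_of_one_lt one_lt_two)

theorem eventually_floor_le {q : ℝ} (hq₀ : 0 < q) (hq₁ : q < 1) :
    ∀ᶠ m : ℕ in atTop, 1 ≤ ⌊q / 2 * ((2 ^ m - 1 : ℕ) : ℝ)⌋₊ ∧
      ⌊q / 2 * ((2 ^ m - 1 : ℕ) : ℝ)⌋₊ ≤ 2 ^ (m - 1) - 1 := by
  -- The first threshold makes the floor at least `1`. The second gives `q n₁ ≤ n₁ - 1`, and `(n₁ -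
  -- 1)/2 = 2^(m-1) - 1`.
  have h1 := tendsto_two_pow_sub_one.eventually_ge_atTop (2 / q)
  have h2 := tendsto_two_pow_sub_one.eventually_ge_atTop (1 / (1 - q))
  filter_upwards [h1, h2, eventually_ge_atTop 1] with m hm₁ hm₂ hm
  rw [div_le_iff₀ hq₀] at hm₁
  rw [div_le_iff₀ (by linarith)] at hm₂
  constructor
  · refine Nat.le_floor ?_
    push_cast
    linarith
  · obtain ⟨m, rfl⟩ := Nat.exists_eq_add_of_le' hm
    rw [Nat.add_sub_cancel]
    have h3 : ((2 ^ m - 1 : ℕ) : ℝ) = (((2 ^ (m + 1) - 1 : ℕ) : ℝ) - 1) / 2 := by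
      rw [Nat.cast_sub Nat.one_le_two_pow, Nat.cast_sub Nat.one_le_two_pow]
      push_cast
      ring
    refine Nat.cast_le (α := ℝ).1 ((Nat.floor_le (by positivity)).trans ?_)
    rw [h3]
    linarith

/-- Generalized concatenated quantum codes meeting prescribed inner relative distances `x j` below
the Gilbert–Varshamov bound. -/
theorem eventually_exists_construction {s : ℕ} (hs : 2 ≤ s) {δ r : ℝ} (hδ : 0 < δ) (hr₀ : 0 < r)
    (hr₁ : r < 1) {x : Fin s → ℝ} (hx₀ : ∀ j, δ < x j) (hx₁ : ∀ j, x j ≤ 3 / 4)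
    (hx : ∀ j : Fin s, H4 (x j) < 1 / 2 * (1 - r * ((j : ℕ) + 1 : ℕ) / s)) :
    ∀ᶠ m : ℕ in atTop, ∃ Q : Construction s, m ≤ Q.length ∧ δ / 2 ≤ quantumRelDist Q.code ∧
      quantumRate Q.code = (m / ⌈s / r * m⌉₊ : ℝ) *
        (s - ∑ i, 2 * (⌊δ / x i / 2 * ((2 ^ m - 1 : ℕ) : ℝ)⌋₊ : ℝ) / ((2 ^ m - 1 : ℕ) : ℝ)) := by
  classical
  have hs' : (0 : ℝ) < s := by exact_mod_cast (by omega : 0 < s)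
  have hn : Tendsto (fun m : ℕ => ⌈s / r * (m : ℝ)⌉₊) atTop atTop :=
    tendsto_nat_ceil_atTop.comp (tendsto_natCast_atTop_atTop.const_mul_atTop (by positivity))
  have hcount := hn.eventually (eventually_sum_rpow_lt fun j => sub_pos.2 (hx j))
  have hk : ∀ᶠ m : ℕ in atTop, ∀ i : Fin s, 1 ≤ ⌊δ / x i / 2 * ((2 ^ m - 1 : ℕ) : ℝ)⌋₊ ∧
      ⌊δ / x i / 2 * ((2 ^ m - 1 : ℕ) : ℝ)⌋₊ ≤ 2 ^ (m - 1) - 1 := by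
    rw [eventually_all]
    intro i
    have := hδ.trans (hx₀ i)
    exact eventually_floor_le (by positivity) ((div_lt_one this).2 (hx₀ i))
  filter_upwards [hcount, hk, eventually_ge_atTop 1] with m hcount hk hm
  -- Rounding up gives `sm ≤ rn`, as the counting bound requires, with `m/n → r/s`.
  set n := ⌈s / r * (m : ℝ)⌉₊ with hn_def
  have hmn : (s * m : ℝ) ≤ r * n := by
    have h := Nat.le_ceil (s / r * (m : ℝ))
    have h' := mul_le_mul_of_nonneg_left h hr₀.le
    have e : r * (s / r * (m : ℝ)) = s * m := by field_simp
    rwa [e] at h'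
  have hmn' : s * m ≤ n := by
    have : (s * m : ℝ) ≤ n := hmn.trans (by nlinarith [Nat.cast_nonneg (α := ℝ) n])
    exact_mod_cast this
  obtain ⟨C, ρ, h1, h2, h3, h4, h5, h6⟩ := exists_nested_avoiding hmn'
    (fun j => {v : Fin n → F4 | (hammingNorm v : ℝ) ≤ x j * n})
    (sum_card_hammingBall_lt (by omega) hmn (fun j => hδ.trans (hx₀ j)) hx₁ hcount)
  choose B hB using fun i => exists_isQuantumRS (hk i).1 (hk i).2
  let Q : Construction s :=
    { two_le := hs, m := m, n₂ := n, k := _, B := B, outer := hB, C := C,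
      inner_selfOrthogonal := h1, inner_dim := h2, inner_nested := h3, ρ := ρ, ρ_inner := h4,
      ρ_blocks := h5 }
  refine ⟨Q, ?_, ?_, Q.quantumRate_code⟩
  · have h7 : 1 ≤ 2 ^ m - 1 := by
      have := Nat.pow_le_pow_right (show 1 ≤ 2 by norm_num) hm
      omega
    change m ≤ (2 ^ m - 1) * n
    nlinarith
  · refine Q.le_quantumRelDist (d := fun j => x j * n) (fun j => ?_) (fun j v hv hv0 => ?_)
      fun j => ?_
    · exact mul_nonneg (hδ.trans (hx₀ j)).le (Nat.cast_nonneg _)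
    · have := h6 j v hv hv0
      simp only [Finset.mem_filter, Finset.mem_univ, true_and, not_le] at this
      exact this.le
    · have hxj := hδ.trans (hx₀ j)
      -- The extra `1` in `k_j + 1` absorbs the floor: `k_j + 1 ≥ δ n₁/(2 x_j)`, so the distance
      -- bound has no rounding loss.
      have h8 := (Nat.lt_floor_add_one (δ / x j / 2 * ((2 ^ m - 1 : ℕ) : ℝ))).le
      have h9 := mul_le_mul_of_nonneg_right h8 (mul_nonneg hxj.le (Nat.cast_nonneg (α := ℝ) n))
      refine le_trans (le_of_eq ?_) h9
      change δ / 2 * (((2 ^ m - 1 : ℕ) : ℝ) * (n : ℝ)) = _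
      field_simp

/-! ### Limit of the rates -/

theorem tendsto_rate {s : ℕ} (hs : 0 < s) {δ r : ℝ} (hδ : 0 < δ) (hr₀ : 0 < r) {x : Fin s → ℝ}
    (hx₀ : ∀ j, δ < x j) :
    Tendsto (fun m : ℕ => (m / ⌈s / r * m⌉₊ : ℝ) *
        (s - ∑ i, 2 * (⌊δ / x i / 2 * ((2 ^ m - 1 : ℕ) : ℝ)⌋₊ : ℝ) / ((2 ^ m - 1 : ℕ) : ℝ)))
      atTop (𝓝 (r - r / s * ∑ i, δ / x i)) := by
  have hs' : (0 : ℝ) < s := by exact_mod_cast hs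
  have h1 := ((tendsto_nat_ceil_mul_div_atTop (R := ℝ) (a := s / r) (by positivity)).comp
    tendsto_natCast_atTop_atTop).inv₀ (by positivity)
  have h2 : ∀ i, Tendsto (fun m : ℕ => 2 * (⌊δ / x i / 2 * ((2 ^ m - 1 : ℕ) : ℝ)⌋₊ : ℝ) /
      ((2 ^ m - 1 : ℕ) : ℝ)) atTop (𝓝 (δ / x i)) := by
    intro i
    have hxi := hδ.trans (hx₀ i)
    have h := ((tendsto_nat_floor_mul_div_atTop (R := ℝ) (a := δ / x i / 2) (by positivity)).comp
      tendsto_two_pow_sub_one).const_mul 2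
    rw [mul_div_cancel₀ _ (two_ne_zero' ℝ)] at h
    refine h.congr fun m => ?_
    simp only [Function.comp_apply]
    ring
  have h3 := (h1.mul (tendsto_const_nhds (x := (s : ℝ)) |>.sub
    (tendsto_finsetSum Finset.univ fun i _ => h2 i)))
  have e : (s / r : ℝ)⁻¹ * (s - ∑ i, δ / x i) = r - r / s * ∑ i, δ / x i := by
    field_simp
  rw [e] at h3
  refine h3.congr fun m => ?_
  simp only [Function.comp_apply, inv_div]

/-- The inner distances must lie strictly below the Gilbert–Varshamov values, so these are lowered
by a small `z > 0`. Half of `ε` pays for `z`, the other half for stopping at a finite `m`. -/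
theorem exists_construction_near {s : ℕ} (hs : 2 ≤ s) {δ r : ℝ} (hδ₀ : 0 < δ)
    (hδ₁ : δ < H4inv (1 / 2)) (hr : r ∈ Set.Ioo 0 (1 - 2 * H4 δ)) {ε : ℝ} (hε : 0 < ε) (N : ℕ) :
    ∃ Q : Construction s, N ≤ Q.length ∧ δ / 2 ≤ quantumRelDist Q.code ∧
      |quantumRate Q.code - rateExpr s δ r| < ε := by
  obtain ⟨hδm, hH0, hH1⟩ := H4_bounds_of_lt hδ₀ hδ₁
  have hr₁ : r < 1 := by linarith [hr.2]
  let a : Fin s → ℝ := fun j => 1 / 2 * (1 - r * ((j : ℕ) + 1 : ℕ) / s)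
  have hu : ∀ j : Fin s, r * ((j : ℕ) + 1 : ℕ) / s ∈ Set.Ico (0 : ℝ) 1 := fun j =>
    mul_div_mem_Ico j.isLt hr.1.le hr₁
  have ha : ∀ j, a j ∈ Set.Icc (0 : ℝ) 1 := fun j =>
    ⟨by simp only [a]; linarith [(hu j).2], by simp only [a]; linarith [(hu j).1]⟩
  have hy : ∀ j, δ < H4inv (a j) := fun j =>
    lt_H4inv_half_one_sub hδ₀ hδ₁ (hu j).1 ((mul_div_le j.isLt hr.1.le).trans_lt hr.2)
  have hR : rateExpr s δ r = r - r / s * ∑ j, δ / H4inv (a j) := by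
    rw [rateExpr, sum_Icc_one_eq_sum_fin]
  have hlim : Tendsto (fun z : ℝ => r - r / s * ∑ j, δ / (H4inv (a j) - z)) (𝓝[>] 0)
      (𝓝 (rateExpr s δ r)) := by
    rw [hR]
    refine tendsto_const_nhds.sub (Tendsto.const_mul _ (tendsto_finsetSum _ fun j _ => ?_))
    have : Tendsto (fun z : ℝ => H4inv (a j) - z) (𝓝[>] 0) (𝓝 (H4inv (a j))) := by
      have h : Tendsto (fun z : ℝ => H4inv (a j) - z) (𝓝 0) (𝓝 (H4inv (a j) - 0)) :=
        tendsto_const_nhds.sub tendsto_id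
      rw [sub_zero] at h
      exact h.mono_left nhdsWithin_le_nhds
    exact tendsto_const_nhds.div this (hδ₀.trans (hy j)).ne'
  have hclose := Metric.tendsto_nhds.1 hlim (ε / 2) (by linarith)
  have hlt : ∀ᶠ z : ℝ in 𝓝[>] 0, ∀ j, z < H4inv (a j) - δ := by
    rw [eventually_all]
    exact fun j => nhdsWithin_le_nhds (eventually_lt_nhds (sub_pos.2 (hy j)))
  obtain ⟨z, hz, hzlt, hz0⟩ := (hclose.and (hlt.and self_mem_nhdsWithin)).exists
  have hz0 : 0 < z := hz0
  have hx₀ : ∀ j, δ < H4inv (a j) - z := fun j => by linarith [hzlt j]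
  have hx₁ : ∀ j, H4inv (a j) - z ≤ 3 / 4 := fun j => by linarith [(H4inv_mem (ha j)).2]
  have hx : ∀ j, H4 (H4inv (a j) - z) < a j := by
    intro j
    conv_rhs => rw [← H4_H4inv (ha j)]
    exact H4_strictMonoOn ⟨(hδ₀.trans (hx₀ j)).le, hx₁ j⟩ (H4inv_mem (ha j)) (by linarith)
  have hrate := Metric.tendsto_nhds.1 (tendsto_rate (by omega) hδ₀ hr.1 hx₀) (ε / 2) (by linarith)
  obtain ⟨m, hm, ⟨Q, hQ₁, hQ₂, hQ₃⟩, hmN⟩ := (hrate.and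
    ((eventually_exists_construction hs hδ₀ hr.1 hr₁ hx₀ hx₁ hx).and
      (eventually_ge_atTop N))).exists
  refine ⟨Q, hmN.trans hQ₁, hQ₂, ?_⟩
  rw [← hQ₃] at hm
  have := dist_triangle (quantumRate Q.code)
    (r - r / s * ∑ j, δ / (H4inv (a j) - z)) (rateExpr s δ r)
  rw [← Real.dist_eq]
  linarith

end GCQ

end

/-! ### The main theorem -/

theorem mainTheorem4 (s : ℕ) (hs : 2 ≤ s) (δ : ℝ) (hδ₀ : 0 < δ) (hδ₁ : δ < GCQ.H4inv (1 / 2)) :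
    ∃ R : ℝ,
      IsGreatest (GCQ.rateExpr s δ '' Set.Ioo 0 (1 - 2 * GCQ.H4 δ)) R ∧
      ∃ Q : ℕ → GCQ.Construction s,
        Tendsto (fun t => (Q t).length) atTop atTop ∧
        (∀ t, GCQ.IsSelfOrthogonal (Q t).code) ∧
        (∀ t, δ / 2 ≤ GCQ.quantumRelDist (Q t).code) ∧
        Tendsto (fun t => GCQ.quantumRate (Q t).code) atTop (𝓝 R) := by
  obtain ⟨r, hr, hmax⟩ := GCQ.exists_isMaxOn_rateExpr hs hδ₀ hδ₁
  refine ⟨_, ⟨⟨r, hr, rfl⟩, ?_⟩, ?_⟩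
  · rintro _ ⟨x, hx, rfl⟩
    exact hmax hx
  -- The `t`-th code is taken at the maximising `r`, with length at least `t` and rate within
  -- `1/(t+1)` of the maximum.
  choose Q hQ₁ hQ₂ hQ₃ using fun t : ℕ =>
    GCQ.exists_construction_near hs hδ₀ hδ₁ hr (Nat.one_div_pos_of_nat (α := ℝ) (n := t)) t
  refine ⟨Q, tendsto_atTop_mono hQ₁ tendsto_id, fun t => (Q t).code_selfOrthogonal, hQ₂, ?_⟩
  rw [tendsto_iff_norm_sub_tendsto_zero]
  exact squeeze_zero (fun _ => norm_nonneg _) (fun t => (hQ₃ t).le)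
    tendsto_one_div_add_atTop_nhds_zero_nat
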